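/- Let $g\ge 2$. On $V=\mathbb{Q}[x_1,x_2,\ldots]$, graded by $\deg x_i=i$, with $\partial_i=\partial/\partial x_i$, put $$D=-g\,\partial_1+\frac12\sum_{m,n\ge 1}\binom{m+n}{m}x_{m+n-1}\partial_m\partial_n .$$ Let $I_g\subset V$ be the $\mathbb{Q}$-linear span of all homogeneous polynomials of degree $>g$ and of all polynomials $D^d(x_1^{m_1}\cdots x_k^{m_k})$ with $d\ge 0$, $m_1+2m_2+\cdots+km_k=g$ and $m_1<g$. Let $R_g^{\mathrm{Jac}}=V/I_g$, and write $p_1^{n}p_{n_1}\cdots p_{n_k}$ for the image in $R_g^{\mathrm{Jac}}$ of $x_1^{n}x_{n_1}\cdots x_{n_k}$. Put $x_1^{[a]}=x_1^a/a!$ for $a\ge 0$ and $x_1^{[a]}=0$ for $a<0$, and similarly for $p_1^{[a]}$. Then: (i) $I_g=\bigcap_{n\ge 1}\operatorname{im}(D^n)$, where $\operatorname{im}(D^n)$ is the image of $D^n$ acting on $V$. (ii) $I_g$ is an ideal of $V$, so $R_g^{\mathrm{Jac}}$ is a commutative ring. (iii) There is a unique linear operator $S$ on $R_g^{\mathrm{Jac}}$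 such that for all $n,k\ge 0$ and all $n_1,\ldots,n_k>1$ $$(-1)^nS\bigl(p_1^{[n]}p_{n_1}\cdots p_{n_k}\bigr)=\sum_{\{1,\ldots,k\}=J_1\sqcup\cdots\sqcup J_m}b(J_1)\cdots b(J_m)\,p_1^{[g-n-m-\sum_i n_i]}\,p_{d(J_1)}\cdots p_{d(J_m)},$$ the sum being over all unordered partitions of $\{1,\ldots,k\}$ into nonempty subsets, with $b(J)=\bigl(\sum_{i\in J}n_i\bigr)!\big/\prod_{i\in J}n_i!$ and $d(J)=\sum_{i\in J}n_i-|J|+1$. It satisfies, for all $n,k\ge 0$ and all $n_1,\ldots,n_k>1$, $$S^2(p_1^np_{n_1}\cdots p_{n_k})=(-1)^{g+k+\sum_i n_i}\,p_1^np_{n_1}\cdots p_{n_k}.$$ (iv) The operators $e(F)=x_1F$, $f=-D$ and $h=-g+\sum_{n\ge 1}(n+1)x_n\partial_n$ on $V$ define a representation of the Lie algebra $\mathfrak{sl}_2$ (with $e,f,h$ the images of the standard basis). They preserve $I_g$ and hence define a representation of $\mathfrak{sl}_2$ on $R_g^{\mathrm{Jac}}$. The operator $S$ is invertible, and on $R_g^{\mathrm{Jac}}$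 one has $SeS^{-1}=-f$, $SfS^{-1}=-e$ and $ShS^{-1}=-h$. -/

import Mathlib

attribute [local instance] LieRing.ofAssociativeRing

namespace JacobianRing

noncomputable section

/-- The polynomial ring `ℚ[x₁, x₂, …]` in countably many variables. -/
abbrev Poly : Type := MvPolynomial ℕ+ ℚ

/-- The variable `x_n`, for a natural number `n ≥ 1`. -/
def x (n : ℕ) : Poly := MvPolynomial.X n.toPNat'

/-- The partial derivative `∂_n`. -/
def pd (n : ℕ+) : Poly →ₗ[ℚ] Poly := (MvPolynomial.pderiv n).toLinearMap

lemma pd_eq_zero {n : ℕ+} {F : Poly} (h : n ∉ F.vars) : pd n F = 0 :=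
  MvPolynomial.pderiv_eq_zero_of_notMem_vars h

lemma pd_comm (m n : ℕ+) (F : Poly) : pd m (pd n F) = pd n (pd m F) := by
  have h : ⁅(MvPolynomial.pderiv m : Derivation ℚ Poly Poly),
      (MvPolynomial.pderiv n : Derivation ℚ Poly Poly)⁆ = 0 := by
    apply MvPolynomial.derivation_ext
    intro i
    simp only [Derivation.commutator_apply, MvPolynomial.pderiv_X, Derivation.zero_apply,
      Pi.single_apply]
    split_ifs <;> simp
  have h2 := congrArg (fun d : Derivation ℚ Poly Poly => d F) h
  simp only [Derivation.commutator_apply, Derivation.zero_apply] at h2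
  exact sub_eq_zero.mp h2

lemma finite_support_first (c : ℕ+ → Poly) (F : Poly) :
    (Function.support fun n : ℕ+ => c n * pd n F).Finite := by
  refine F.vars.finite_toSet.subset fun n hn => ?_
  by_contra h
  exact hn (by simp only [pd_eq_zero h, mul_zero])

lemma finite_support_second (c : ℕ+ × ℕ+ → Poly) (F : Poly) :
    (Function.support fun p : ℕ+ × ℕ+ => c p * pd p.1 (pd p.2 F)).Finite := by
  refine (F.vars ×ˢ F.vars).finite_toSet.subset fun p hp => ?_
  by_contra h
  apply hp
  rw [Finset.mem_coe, Finset.mem_product, not_and_or] at h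
  rcases h with h | h
  · simp only [pd_comm p.1, pd_eq_zero h, map_zero, mul_zero]
  · simp only [pd_eq_zero h, map_zero, mul_zero]

/-- The first order differential operator `∑_{n ≥ 1} c_n ∂_n`. -/
def diffOp₁ (c : ℕ+ → Poly) : Poly →ₗ[ℚ] Poly where
  toFun F := ∑ᶠ n : ℕ+, c n * pd n F
  map_add' F G := by
    simp only [map_add, mul_add]
    exact finsum_add_distrib (finite_support_first c F) (finite_support_first c G)
  map_smul' a F := by
    simp only [map_smul, mul_smul_comm, RingHom.id_apply]
    exact (smul_finsum' a (finite_support_first c F)).symm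

/-- The second order differential operator `∑_{m, n ≥ 1} c_{m,n} ∂_m ∂_n`. -/
def diffOp₂ (c : ℕ+ × ℕ+ → Poly) : Poly →ₗ[ℚ] Poly where
  toFun F := ∑ᶠ p : ℕ+ × ℕ+, c p * pd p.1 (pd p.2 F)
  map_add' F G := by
    simp only [map_add, mul_add]
    exact finsum_add_distrib (finite_support_second c F) (finite_support_second c G)
  map_smul' a F := by
    simp only [map_smul, mul_smul_comm, RingHom.id_apply]
    exact (smul_finsum' a (finite_support_second c F)).symm

/-- `D = -g ∂₁ + (1/2) ∑_{m, n ≥ 1} (m+n choose m) x_{m+n-1} ∂_m ∂_n`. -/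
def D (g : ℕ) : Module.End ℚ Poly :=
  -(g : ℚ) • pd 1 +
    (1 / 2 : ℚ) • diffOp₂ fun p => (Nat.choose (p.1 + p.2) p.1 : ℚ) • x ((p.1 : ℕ) + p.2 - 1)

/-- `e(F) = x₁ F`. -/
def eOp : Module.End ℚ Poly := LinearMap.mulLeft ℚ (x 1)

/-- `f = -D`. -/
def fOp (g : ℕ) : Module.End ℚ Poly := -D g

/-- `h = -g + ∑_{n ≥ 1} (n+1) x_n ∂_n`. -/
def hOp (g : ℕ) : Module.End ℚ Poly :=
  -(g : ℚ) • LinearMap.id + diffOp₁ fun n => ((n : ℚ) + 1) • x n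

/-- The grading `deg x_i = i`. -/
def wt (i : ℕ+) : ℕ := i

/-- `I_g`: the span of the `D^d (x₁^{m₁} ⋯ x_k^{m_k})` with `d ≥ 0`, `∑ i m_i = g`, `m₁ < g`,
and of the homogeneous polynomials of degree `> g`. -/
def I (g : ℕ) : Submodule ℚ Poly :=
  Submodule.span ℚ
    ({F | ∃ (d : ℕ) (m : ℕ+ →₀ ℕ), Finsupp.weight wt m = g ∧ m 1 < g ∧
        F = (D g ^ d) (MvPolynomial.monomial m 1)} ∪
      {F | ∃ n > g, MvPolynomial.IsWeightedHomogeneous wt F n})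

/-- `R_g = ℚ[x₁, x₂, …] / I_g`, as a quotient vector space. -/
abbrev R (g : ℕ) : Type := Poly ⧸ I g

/-- `x₁^{[a]} = x₁^a / a!` for `a ≥ 0`, and `0` for `a < 0`. -/
def x₁div (a : ℤ) : Poly := if 0 ≤ a then (1 / (Nat.factorial a.toNat : ℚ)) • x 1 ^ a.toNat else 0

/-- `b(J) = (∑_{i ∈ J} n_i)! / ∏_{i ∈ J} n_i!`. -/
def b {k : ℕ} (ν : Fin k → ℕ) (J : Finset (Fin k)) : ℚ :=
  (Nat.factorial (∑ i ∈ J, ν i) : ℚ) / ∏ i ∈ J, (Nat.factorial (ν i) : ℚ)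

/-- `d(J) = ∑_{i ∈ J} n_i - |J| + 1` (nonnegative when all `n_i ≥ 1`). -/
def dIdx {k : ℕ} (ν : Fin k → ℕ) (J : Finset (Fin k)) : ℕ := ∑ i ∈ J, ν i + 1 - J.card

/-- The sum, over all unordered partitions `{1, …, k} = J₁ ⊔ … ⊔ J_m` into nonempty subsets, of
`b(J₁) ⋯ b(J_m) x₁^{[g - n - m - ∑ n_i]} x_{d(J₁)} ⋯ x_{d(J_m)}`. -/
def fourierSum (g n : ℕ) {k : ℕ} (ν : Fin k → ℕ) : Poly :=
  ∑ P : Finpartition (Finset.univ : Finset (Fin k)),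
    (∏ J ∈ P.parts, b ν J) •
      (x₁div ((g : ℤ) - n - P.parts.card - ∑ i, (ν i : ℤ)) * ∏ J ∈ P.parts, x (dIdx ν J))

/-- The linear operator `S` on `R_g` satisfies the explicit formula
`(-1)^n S(p₁^{[n]} p_{n₁} ⋯ p_{n_k}) = ∑ b(J₁) ⋯ b(J_m) p₁^{[g-n-m-∑ n_i]} p_{d(J₁)} ⋯ p_{d(J_m)}`
for all `n ≥ 0`, `k ≥ 0` and `n₁, …, n_k > 1`. -/
def FourierFormula (g : ℕ) (S : R g →ₗ[ℚ] R g) : Prop :=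
  ∀ (n k : ℕ) (ν : Fin k → ℕ), (∀ i, 1 < ν i) →
    (-1 : ℚ) ^ n • S ((I g).mkQ (x₁div n * ∏ i, x (ν i))) = (I g).mkQ (fourierSum g n ν)

/-- The Lie algebra `sl₂` of traceless `2 × 2` matrices. -/
abbrev sl₂ : Type := LieAlgebra.SpecialLinear.sl (Fin 2) ℚ

/-- The matrix `e = !![0, 1; 0, 0]`. -/
def E : sl₂ := LieAlgebra.SpecialLinear.single 0 1 (by decide) 1

/-- The matrix `f = !![0, 0; 1, 0]`. -/
def Fm : sl₂ := LieAlgebra.SpecialLinear.single 1 0 (by decide) 1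

/-- The matrix `h = !![1, 0; 0, -1]`. -/
def H : sl₂ := LieAlgebra.SpecialLinear.singleSubSingle 0 1 1

end

end JacobianRing

/-!
Let `d = D`, `e = x₁ ·` and `h = [d, e]`, so that `(h, e, -d)` satisfies the relations of `sl₂`.
For a vector `w` of weight `-c` with `d ^ N w = 0`, put `w_a = ∑_j e^{[a + j]} d^{[j]} w`. The sum
telescopes to `d w_a = (a - 1 - c) w_{a - 1}`, so `w_a` lies in the image of every power of `d` as
soon as `a > c`. Products `w` of variables `x_n` with `n > 1` are weight vectors killed by a power
of `d`, and solving for `e^{[a]} w` shows that the generators of `I_g` lie in `⋂ im (D ^ n)`. The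
converse holds for degree reasons, since the coefficient of `x₁ ^ g` in `D (x₁ ^ (g + 1))` vanishes.
Multiplication by each `x_k` is killed by a power of `ad D`: the operators needed for this obey the
commutation rules of the Poisson brackets of the monomials `yⁱ tᵐ`. Hence `I_g` is an ideal.

On the quotient `e` and `d` are nilpotent, and `S = exp d exp e exp d` is the Weyl element, which
conjugates `e`, `d`, `h` to `d`, `e`, `-h`. There `exp e exp d w = ∑_a w_a`, and `w_a = 0` for
`a > c`, so this sum is `exp (-d) w_c` and therefore `S w = w_c`. Each application of `D` to a
product of variables `x_n` with `n > 1` merges two of them, so `D^{[j]} w` is a sum over the set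
partitions of the factors into `k - j` parts, which turns `w_c` into the formula for `S`.
-/

open MvPolynomial

namespace JacobianRing

noncomputable section

section DividedPowers

variable {A B : Type*} [Ring A] [Algebra ℚ A] [Ring B] [Algebra ℚ B]

/-- The divided power `aⁿ / n!`, extended by `0` to negative `n`; for `a = x₁` it is `x₁^{[n]}`. -/
def divPow (a : A) (n : ℤ) : A := if 0 ≤ n then (1 / (n.toNat.factorial : ℚ)) • a ^ n.toNat else 0

lemma divPow_natCast (a : A) (n : ℕ) : divPow a n = (1 / (n.factorial : ℚ)) • a ^ n := by
  simp [divPow]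

lemma divPow_of_neg (a : A) {n : ℤ} (hn : n < 0) : divPow a n = 0 := by
  simp [divPow, not_le.mpr hn]

@[simp]
lemma divPow_zero (a : A) : divPow a 0 = 1 := by simp [divPow]

lemma divPow_eq_zero {a : A} {N : ℕ} (ha : a ^ N = 0) {n : ℤ} (hn : N ≤ n) : divPow a n = 0 := by
  lift n to ℕ using (Int.natCast_nonneg N).trans hn
  rw [divPow_natCast, pow_eq_zero_of_le (by exact_mod_cast hn) ha, smul_zero]

lemma divPow_neg_left (a : A) (n : ℤ) : divPow (-a) n = (-1 : ℚ) ^ n • divPow a n := by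
  rcases lt_or_ge n 0 with hn | hn
  · rw [divPow_of_neg _ hn, divPow_of_neg _ hn, smul_zero]
  lift n to ℕ using hn
  rcases n.even_or_odd with hn | hn <;> simp [divPow_natCast, hn.neg_pow]

lemma map_divPow (φ : A →ₐ[ℚ] B) (a : A) (n : ℤ) : φ (divPow a n) = divPow (φ a) n := by
  simp only [divPow, apply_ite φ, map_smul, map_pow, map_zero]

lemma commute_divPow (a : A) (n : ℤ) : Commute a (divPow a n) := by
  unfold divPow
  split_ifs
  · exact ((Commute.refl a).pow_right _).smul_right _
  · exact Commute.zero_right a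

lemma mul_divPow (a : A) (n : ℤ) : a * divPow a n = (n + 1 : ℚ) • divPow a (n + 1) := by
  rcases lt_or_ge n 0 with hn | hn
  · rw [divPow_of_neg a hn, mul_zero]
    rcases eq_or_ne n (-1) with rfl | hn'
    · simp
    · rw [divPow_of_neg a (by lia), smul_zero]
  · lift n to ℕ using hn
    rw [show (n : ℤ) + 1 = (n + 1 : ℕ) by push_cast; rfl, divPow_natCast, divPow_natCast,
      mul_smul_comm, smul_smul, pow_succ', Nat.factorial_succ]
    congr 1
    push_cast
    field_simp

end DividedPowers

/-- The relations of `sl₂` for the triple `(h, e, f)` with `f = -d`, the form in which the operator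
`D` enters. Unlike in Mathlib's `IsSl2Triple`, `h` may vanish, so that the relations pass to
quotients. -/
structure IsSl2Relation {L : Type*} [LieRing L] (h e d : L) : Prop where
  lie_d_e : ⁅d, e⁆ = h
  lie_h_e : ⁅h, e⁆ = 2 • e
  lie_h_d : ⁅h, d⁆ = -(2 • d)

namespace IsSl2Relation

section Lie

variable {L : Type*} [LieRing L] {h e d : L}

lemma symm (rel : IsSl2Relation h e d) : IsSl2Relation (-h) d e where
  lie_d_e := by rw [← lie_skew, rel.lie_d_e]
  lie_h_e := by rw [neg_lie, rel.lie_h_d, neg_neg]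
  lie_h_d := by rw [neg_lie, rel.lie_h_e]

lemma neg (rel : IsSl2Relation h e d) : IsSl2Relation h (-e) (-d) where
  lie_d_e := by rw [neg_lie, lie_neg, neg_neg, rel.lie_d_e]
  lie_h_e := by rw [lie_neg, rel.lie_h_e, smul_neg]
  lie_h_d := by rw [lie_neg, rel.lie_h_d, smul_neg]

end Lie

section Algebra

variable {A : Type*} [Ring A] {h e d : A}

lemma d_mul_e (rel : IsSl2Relation h e d) : d * e = e * d + h := by
  rw [← rel.lie_d_e, Ring.lie_def, add_sub_cancel]

variable [Algebra ℚ A]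

lemma h_mul_e (rel : IsSl2Relation h e d) : h * e = e * (h + (2 : ℚ) • 1) := by
  have := rel.lie_h_e
  rw [Ring.lie_def, sub_eq_iff_eq_add] at this
  rw [this, mul_add, mul_smul_comm, mul_one, add_comm, ofNat_smul_eq_nsmul ℚ]

lemma h_mul_divPow_e (rel : IsSl2Relation h e d) (n : ℕ) :
    h * divPow e n = divPow e n * (h + (2 * n : ℚ) • 1) := by
  rw [divPow_natCast, mul_smul_comm, smul_mul_assoc]
  congr 1
  induction n with
  | zero => simp
  | succ n ih =>
    rw [pow_succ', ← mul_assoc, rel.h_mul_e, mul_assoc, add_mul, ih]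
    simp only [mul_add, smul_mul_assoc, mul_smul_comm, one_mul, mul_one, ← mul_assoc, Nat.cast_succ]
    module

lemma d_mul_divPow_e (rel : IsSl2Relation h e d) (n : ℤ) :
    d * divPow e n = divPow e n * d + divPow e (n - 1) * (h + (n - 1 : ℚ) • 1) := by
  rcases lt_or_ge n 0 with hn | hn
  · rw [divPow_of_neg e hn, divPow_of_neg e (by lia)]; simp
  lift n to ℕ using hn
  induction n with
  | zero => simp [divPow]
  | succ n ih =>
    have e_mul := mul_divPow e n
    have e_mul_pred := mul_divPow e (n - 1)
    simp only [Int.cast_natCast, Int.cast_sub, Int.cast_one, sub_add_cancel] at e_mul e_mul_pred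
    refine smul_right_injective A (Nat.cast_add_one_ne_zero n : (n + 1 : ℚ) ≠ 0) ?_
    push_cast at ih ⊢
    calc (n + 1 : ℚ) • (d * divPow e (n + 1))
        = e * (d * divPow e n) + h * divPow e n := by
          rw [← mul_smul_comm, ← e_mul, ← mul_assoc, rel.d_mul_e, add_mul, mul_assoc]
      _ = (e * divPow e n) * d + (e * divPow e (n - 1)) * (h + (n - 1 : ℚ) • 1) +
            divPow e n * (h + (2 * n : ℚ) • 1) := by
          rw [ih, rel.h_mul_divPow_e, mul_add, mul_assoc, mul_assoc]
      _ = _ := by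
          rw [e_mul, e_mul_pred, add_sub_cancel_right]
          simp only [mul_add, smul_mul_assoc, mul_smul_comm, mul_one]
          module

end Algebra

end IsSl2Relation

section StringSum

variable {M : Type*} [AddCommGroup M] [Module ℚ M] {h e d : Module.End ℚ M} {c : ℤ} {w : M}

/-- The `a`-th homogeneous part `∑_{j < N} e^{[a + j]} d^{[j]}` of the product `exp e * exp d`,
truncated so that it makes sense for vectors `w` with `d ^ N w = 0` even when `e` and `d` are not
nilpotent. -/
def stringSum (e d : Module.End ℚ M) (N : ℕ) (a : ℤ) : Module.End ℚ M :=
  ∑ j ∈ Finset.range N, divPow e (a + j) * divPow d j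

lemma stringSum_apply (N : ℕ) (a : ℤ) (w : M) :
    stringSum e d N a w = ∑ j ∈ Finset.range N, divPow e (a + j) (divPow d j w) := by
  simp [stringSum]

/-- The intersection of the images of all powers of `d`. -/
def stableRange (d : Module.End ℚ M) : Submodule ℚ M := ⨅ n : ℕ, LinearMap.range (d ^ n)

lemma mem_stableRange {F : M} : F ∈ stableRange d ↔ ∀ n : ℕ, F ∈ LinearMap.range (d ^ n) := by
  simp only [stableRange, Submodule.mem_iInf]

lemma stableRange_eq_iInf_one_le (d : Module.End ℚ M) :
    stableRange d = ⨅ (n : ℕ) (_ : 1 ≤ n), LinearMap.range (d ^ n) :=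
  le_antisymm (le_iInf₂ fun n _ => iInf_le _ n) (le_iInf fun n =>
    (iInf₂_le (n + 1) n.succ_pos).trans (LinearMap.range_comp_le_range d (d ^ n)))

namespace IsSl2Relation

lemma h_divPow_d_apply (rel : IsSl2Relation h e d) (hw : h w = -(c : ℚ) • w) (j : ℕ) :
    h (divPow d j w) = -((c + 2 * j : ℤ) : ℚ) • divPow d j w := by
  have := LinearMap.congr_fun (rel.symm.h_mul_divPow_e j) w
  simp only [Module.End.mul_apply, LinearMap.neg_apply, LinearMap.add_apply, LinearMap.smul_apply,
    Module.End.one_apply, hw, map_add, map_smul, map_neg] at this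
  rw [← neg_inj, this]
  push_cast
  module

lemma d_divPow_e_apply (rel : IsSl2Relation h e d) (hw : h w = -(c : ℚ) • w) (a : ℤ) :
    d (divPow e a w) = divPow e a (d w) + (a - 1 - c : ℚ) • divPow e (a - 1) w := by
  have := LinearMap.congr_fun (rel.d_mul_divPow_e a) w
  simp only [Module.End.mul_apply, LinearMap.add_apply, LinearMap.smul_apply,
    Module.End.one_apply, hw, ← add_smul, map_smul] at this
  rw [this]
  module

/-- The terms coming from `d` acting on `divPow d j w` telescope with those coming from the
commutator of `d` and `divPow e (a + j)`. -/
lemma d_stringSum_apply (rel : IsSl2Relation h e d) (hw : h w = -(c : ℚ) • w) {N : ℕ}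
    (hN : (d ^ N) w = 0) (a : ℤ) :
    d (stringSum e d N a w) = (a - 1 - c : ℚ) • stringSum e d N (a - 1) w := by
  let T (j : ℕ) : M := divPow e (a - 1 + j) (divPow d j w)
  have d_term (j : ℕ) : d (divPow e (a + j) (divPow d j w)) =
      (((j + 1 : ℕ) : ℚ) • T (j + 1) - (j : ℚ) • T j) + (a - 1 - c : ℚ) • T j := by
    have d_divPow : d (divPow d j w) = (j + 1 : ℚ) • divPow d (j + 1) w := by
      simpa using LinearMap.congr_fun (mul_divPow d j) w
    rw [rel.d_divPow_e_apply (rel.h_divPow_d_apply hw j), d_divPow, map_smul]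
    simp only [T]
    push_cast
    rw [show a - 1 + ((j : ℤ) + 1) = a + j by ring, show a + j - 1 = a - 1 + j by ring]
    module
  have T_last : T N = 0 := by simp [T, divPow_natCast, hN]
  simp only [stringSum_apply, map_sum, d_term, Finset.sum_add_distrib, ← Finset.smul_sum,
    Finset.sum_range_sub fun j : ℕ => (j : ℚ) • T j]
  simp [T_last, T]

lemma divPow_d_stringSum_apply (rel : IsSl2Relation h e d) (hw : h w = -(c : ℚ) • w) {N : ℕ}
    (hN : (d ^ N) w = 0) (n : ℕ) :
    divPow d n (stringSum e d N c w) = (-1 : ℚ) ^ n • stringSum e d N (c - n) w := by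
  induction n with
  | zero => simp
  | succ n ih =>
    have d_divPow : (n + 1 : ℚ) • divPow d (n + 1) (stringSum e d N c w) =
        d (divPow d n (stringSum e d N c w)) := by
      simpa using (LinearMap.congr_fun (mul_divPow d n) _).symm
    refine smul_right_injective M (Nat.cast_add_one_ne_zero n : (n + 1 : ℚ) ≠ 0) ?_
    push_cast
    simp only [d_divPow]
    rw [ih, map_smul, rel.d_stringSum_apply hw hN]
    push_cast
    rw [show c - ((n : ℤ) + 1) = c - n - 1 by ring]
    module

lemma stringSum_apply_mem_stableRange (rel : IsSl2Relation h e d) (hw : h w = -(c : ℚ) • w) {N : ℕ}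
    (hN : (d ^ N) w = 0) {a : ℤ} (ha : c < a) : stringSum e d N a w ∈ stableRange d := by
  refine mem_stableRange.mpr fun n => ?_
  induction n generalizing a with
  | zero => simp
  | succ n ih =>
    obtain ⟨v, hv⟩ := ih (a := a + 1) (by lia)
    have hac : (a - c : ℚ) ≠ 0 := sub_ne_zero.mpr (by exact_mod_cast ha.ne')
    refine ⟨(a - c : ℚ)⁻¹ • v, ?_⟩
    rw [map_smul, pow_succ', Module.End.mul_apply, hv, rel.d_stringSum_apply hw hN,
      add_sub_cancel_right]
    push_cast
    rw [add_sub_cancel_right, inv_smul_smul₀ hac]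

lemma divPow_e_apply_mem_stableRange (rel : IsSl2Relation h e d) {N : ℕ} (hN : (d ^ N) w = 0)
    (hw : h w = -(c : ℚ) • w) {a : ℤ} (ha : c + N ≤ a) : divPow e a w ∈ stableRange d := by
  induction N using Nat.strong_induction_on generalizing w c a with
  | _ N ih =>
  cases N with
  | zero => simp_all
  | succ N =>
    have mem_sum := rel.stringSum_apply_mem_stableRange hw hN (a := a) (by lia)
    rw [stringSum_apply, Finset.sum_range_succ', Nat.cast_zero, add_zero, divPow_zero,
      Module.End.one_apply] at mem_sum
    refine ((stableRange d).add_mem_iff_right (Submodule.sum_mem _ fun j hj => ?_)).mp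
      mem_sum
    have hj := Finset.mem_range.mp hj
    refine ih (N - j) (by lia) ?_ (rel.h_divPow_d_apply hw (j + 1)) (a := a + (j + 1 : ℕ))
      (by push_cast; lia)
    rw [divPow_natCast, LinearMap.smul_apply, map_smul, ← Module.End.mul_apply, ← pow_add,
      show N - j + (j + 1) = N + 1 by lia, hN, smul_zero]

end IsSl2Relation

end StringSum

section ExpConjugation

variable {A : Type*} [Ring A] [Algebra ℚ A]

lemma exp_mulLeft {a : A} (ha : IsNilpotent a) :
    IsNilpotent.exp (LinearMap.mulLeft ℚ a) = LinearMap.mulLeft ℚ (IsNilpotent.exp a) :=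
  (IsNilpotent.map_exp ha (Algebra.lmul ℚ A)).symm

lemma exp_mulRight {a : A} (ha : IsNilpotent a) :
    IsNilpotent.exp (LinearMap.mulRight ℚ a) = LinearMap.mulRight ℚ (IsNilpotent.exp a) := by
  obtain ⟨n, hn⟩ := ha
  rw [IsNilpotent.exp_eq_sum hn,
    IsNilpotent.exp_eq_sum (k := n)
      (by rw [LinearMap.pow_mulRight, hn, LinearMap.mulRight_zero_eq_zero])]
  ext b
  simp [Finset.mul_sum]

lemma semiconjBy_exp {a b : A} (ha : IsNilpotent a) (hab : ⁅a, ⁅a, ⁅a, b⁆⁆⁆ = 0) :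
    SemiconjBy (IsNilpotent.exp a) b (b + ⁅a, b⁆ + (1 / 2 : ℚ) • ⁅a, ⁅a, b⁆⁆) := by
  have left_nilpotent : IsNilpotent (LinearMap.mulLeft ℚ a) := by simpa using ha
  have right_nilpotent : IsNilpotent (LinearMap.mulRight ℚ a) := by simpa using ha
  have ad_eq : LieAlgebra.ad ℚ A a = LinearMap.mulLeft ℚ a - LinearMap.mulRight ℚ a :=
    congrFun (LieAlgebra.ad_eq_lmul_left_sub_lmul_right A) a
  have commute := LinearMap.commute_mulLeft_right (R := ℚ) a a
  have ad_nilpotent : IsNilpotent (LieAlgebra.ad ℚ A a) :=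
    ad_eq ▸ Commute.isNilpotent_sub commute left_nilpotent right_nilpotent
  have exp_ad : IsNilpotent.exp (LieAlgebra.ad ℚ A a) b =
      b + ⁅a, b⁆ + (1 / 2 : ℚ) • ⁅a, ⁅a, b⁆⁆ := by
    have := IsNilpotent.exp_smul_eq_sum (m := b) (k := 3)
      (by simpa [pow_succ'] using hab) ad_nilpotent
    simpa [Finset.sum_range_succ, pow_succ', Nat.factorial_succ] using this
  have exp_left : IsNilpotent.exp (LinearMap.mulLeft ℚ a) =
      IsNilpotent.exp (LinearMap.mulRight ℚ a) * IsNilpotent.exp (LieAlgebra.ad ℚ A a) := by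
    rw [← IsNilpotent.exp_add_of_commute _ right_nilpotent ad_nilpotent, ad_eq, add_sub_cancel]
    exact ad_eq ▸ (commute.symm.sub_right (.refl _))
  have := LinearMap.congr_fun exp_left b
  rwa [exp_mulLeft ha, exp_mulRight ha, Module.End.mul_apply, exp_ad] at this

lemma semiconjBy_exp_self {a : A} (ha : IsNilpotent a) : SemiconjBy (IsNilpotent.exp a) a a := by
  simpa using semiconjBy_exp (b := a) ha (by simp)

lemma semiconjBy_exp_exp {u a b : A} (hu : SemiconjBy u a b) (ha : IsNilpotent a)
    (hb : IsNilpotent b) :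
    SemiconjBy u (IsNilpotent.exp a) (IsNilpotent.exp b) := by
  obtain ⟨m, hm⟩ := ha
  obtain ⟨n, hn⟩ := hb
  rw [SemiconjBy, IsNilpotent.exp_eq_sum (pow_eq_zero_of_le (le_max_left m n) hm),
    IsNilpotent.exp_eq_sum (pow_eq_zero_of_le (le_max_right m n) hn), Finset.mul_sum,
    Finset.sum_mul]
  exact Finset.sum_congr rfl fun i _ => by
    rw [mul_smul_comm, smul_mul_assoc, (hu.pow_right i).eq]

end ExpConjugation

section Weyl

/-- The action of the Weyl group element of `SL₂`, for the triple `(h, e, -d)`. It is the Fourier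
transform `S` when `e` is multiplication by `p₁` and `d` is `D`. -/
def weyl {A : Type*} [Ring A] [Module ℚ A] (e d : A) : A :=
  IsNilpotent.exp d * IsNilpotent.exp e * IsNilpotent.exp d

section Algebra

variable {A : Type*} [Ring A] [Algebra ℚ A] {h e d : A}

lemma weyl_mul_weyl_neg (he : IsNilpotent e) (hd : IsNilpotent d) :
    weyl e d * weyl (-e) (-d) = 1 := by
  rw [weyl, weyl]
  simp only [mul_assoc]
  rw [← mul_assoc (IsNilpotent.exp d) (IsNilpotent.exp (-d)), IsNilpotent.exp_mul_exp_neg_self hd,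
    one_mul, ← mul_assoc (IsNilpotent.exp e), IsNilpotent.exp_mul_exp_neg_self he, one_mul,
    IsNilpotent.exp_mul_exp_neg_self hd]

lemma isUnit_weyl (he : IsNilpotent e) (hd : IsNilpotent d) : IsUnit (weyl e d) :=
  ((IsNilpotent.isUnit_exp hd).mul (IsNilpotent.isUnit_exp he)).mul (IsNilpotent.isUnit_exp hd)

namespace IsSl2Relation

lemma semiconjBy_exp_e_d (rel : IsSl2Relation h e d) (he : IsNilpotent e) :
    SemiconjBy (IsNilpotent.exp e) d (d - h + e) := by
  have lie_e_d : ⁅e, d⁆ = -h := by rw [← lie_skew, rel.lie_d_e]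
  have lie_e_h : ⁅e, ⁅e, d⁆⁆ = 2 • e := by rw [lie_e_d, lie_neg, lie_skew, rel.lie_h_e]
  convert semiconjBy_exp (b := d) he (by rw [lie_e_h, lie_nsmul, lie_self, smul_zero]) using 1
  rw [lie_e_h, lie_e_d]
  module

lemma semiconjBy_exp_e_h (rel : IsSl2Relation h e d) (he : IsNilpotent e) :
    SemiconjBy (IsNilpotent.exp e) h (h - 2 • e) := by
  have lie_e_h : ⁅e, h⁆ = -(2 • e) := by rw [← lie_skew, rel.lie_h_e]
  have lie_e_lie : ⁅e, ⁅e, h⁆⁆ = 0 := by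
    rw [lie_e_h, lie_neg, lie_nsmul, lie_self, smul_zero, neg_zero]
  convert semiconjBy_exp (b := h) he (by rw [lie_e_lie, lie_zero]) using 1
  rw [lie_e_lie, lie_e_h]
  module

lemma semiconjBy_exp_d_mul_exp_e (rel : IsSl2Relation h e d) (he : IsNilpotent e)
    (hd : IsNilpotent d) : SemiconjBy (IsNilpotent.exp d * IsNilpotent.exp e) d e := by
  have exp_d : SemiconjBy (IsNilpotent.exp d) (d - h + e) e := by
    convert ((semiconjBy_exp_self hd).add_right (rel.symm.semiconjBy_exp_e_h hd)).add_right
      (rel.symm.semiconjBy_exp_e_d hd) using 1 <;> abel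
  exact exp_d.mul_left (rel.semiconjBy_exp_e_d he)

lemma weyl_comm (rel : IsSl2Relation h e d) (he : IsNilpotent e) (hd : IsNilpotent d) :
    weyl d e = weyl e d := by
  have := semiconjBy_exp_exp (rel.semiconjBy_exp_d_mul_exp_e he hd) hd he
  rw [weyl, weyl, this.eq, mul_assoc]

lemma semiconjBy_weyl_d (rel : IsSl2Relation h e d) (he : IsNilpotent e) (hd : IsNilpotent d) :
    SemiconjBy (weyl e d) d e :=
  (rel.semiconjBy_exp_d_mul_exp_e he hd).mul_left (semiconjBy_exp_self hd)

lemma semiconjBy_weyl_e (rel : IsSl2Relation h e d) (he : IsNilpotent e) (hd : IsNilpotent d) :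
    SemiconjBy (weyl e d) e d :=
  rel.weyl_comm he hd ▸ rel.symm.semiconjBy_weyl_d hd he

lemma semiconjBy_weyl_h (rel : IsSl2Relation h e d) (he : IsNilpotent e) (hd : IsNilpotent d) :
    SemiconjBy (weyl e d) h (-h) := by
  have weyl_d := rel.semiconjBy_weyl_d he hd
  have weyl_e := rel.semiconjBy_weyl_e he hd
  have := (weyl_d.mul_right weyl_e).sub_right (weyl_e.mul_right weyl_d)
  rwa [← Ring.lie_def, ← Ring.lie_def, rel.lie_d_e, ← lie_skew, rel.lie_d_e] at this

end IsSl2Relation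

end Algebra

section Module

variable {M : Type*} [AddCommGroup M] [Module ℚ M] {h e d : Module.End ℚ M} {c : ℤ} {w : M}

lemma support_divPow_subset {a : Module.End ℚ M} {N : ℕ} (ha : a ^ N = 0) (v : M) :
    (Function.support fun n : ℤ => divPow a n v) ⊆
      ↑((Finset.range N).map (Nat.castEmbedding (R := ℤ))) := by
  intro n hn
  rcases lt_or_ge n 0 with h0 | h0
  · simp [divPow_of_neg a h0] at hn
  lift n to ℕ using h0
  have : n < N := by
    by_contra! hNn
    exact hn (by simp only [divPow_eq_zero ha (Nat.cast_le.mpr hNn), LinearMap.zero_apply])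
  simpa using this

lemma finsum_divPow_apply {a : Module.End ℚ M} (ha : IsNilpotent a) (v : M) :
    ∑ᶠ n : ℤ, divPow a n v = IsNilpotent.exp a v := by
  obtain ⟨N, hN⟩ := ha
  rw [finsum_eq_sum_of_support_subset _ (support_divPow_subset hN v), Finset.sum_map,
    IsNilpotent.exp_eq_sum hN]
  simp [divPow_natCast]

lemma exp_e_exp_d_apply (he : IsNilpotent e) (hd : IsNilpotent d) {N : ℕ} (hN : (d ^ N) w = 0) :
    IsNilpotent.exp e (IsNilpotent.exp d w) = ∑ᶠ a : ℤ, stringSum e d N a w := by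
  obtain ⟨K, hK⟩ := id he
  have shifted (j : ℕ) (v : M) : IsNilpotent.exp e v = ∑ᶠ a : ℤ, divPow e (a + j) v := by
    rw [← finsum_divPow_apply he, ← finsum_comp_equiv (Equiv.addRight (j : ℤ))]
    rfl
  have exp_d : IsNilpotent.exp d w = ∑ j ∈ Finset.range N, divPow d j w := by
    simpa [divPow_natCast] using IsNilpotent.exp_smul_eq_sum (m := w) hN hd
  calc IsNilpotent.exp e (IsNilpotent.exp d w)
      = ∑ j ∈ Finset.range N, ∑ᶠ a : ℤ, divPow e (a + j) (divPow d j w) := by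
        rw [exp_d, map_sum]
        exact Finset.sum_congr rfl fun j _ => shifted j _
    _ = ∑ᶠ a : ℤ, stringSum e d N a w := by
        rw [sum_finsum_comm]
        · simp only [stringSum_apply]
        · exact fun j _ => ((Finset.finite_toSet _).subset (support_divPow_subset hK _)).preimage
            (add_left_injective (j : ℤ)).injOn

namespace IsSl2Relation

lemma stringSum_apply_eq_zero (rel : IsSl2Relation h e d) (hd : IsNilpotent d)
    (hw : h w = -(c : ℚ) • w) {N : ℕ} (hN : (d ^ N) w = 0) {a : ℤ} (ha : c < a) :
    stringSum e d N a w = 0 := by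
  obtain ⟨K, hK⟩ := hd
  simpa [hK] using mem_stableRange.mp (rel.stringSum_apply_mem_stableRange hw hN ha) K

lemma exp_neg_d_stringSum_apply (rel : IsSl2Relation h e d) (hd : IsNilpotent d)
    (hw : h w = -(c : ℚ) • w) {N : ℕ} (hN : (d ^ N) w = 0) :
    IsNilpotent.exp (-d) (stringSum e d N c w) = ∑ᶠ a : ℤ, stringSum e d N a w := by
  rw [← finsum_divPow_apply hd.neg,
    ← finsum_comp_equiv (Equiv.subLeft c) (f := fun a => stringSum e d N a w)]
  refine finsum_congr fun n => ?_
  rw [Equiv.subLeft_apply]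
  rcases lt_or_ge n 0 with hn | hn
  · rw [divPow_of_neg _ hn, LinearMap.zero_apply,
      rel.stringSum_apply_eq_zero hd hw hN (by lia)]
  · lift n to ℕ using hn
    rw [divPow_neg_left, LinearMap.smul_apply, rel.divPow_d_stringSum_apply hw hN,
      zpow_natCast, smul_smul, ← mul_pow]
    simp

lemma weyl_apply (rel : IsSl2Relation h e d) (he : IsNilpotent e) (hd : IsNilpotent d)
    (hw : h w = -(c : ℚ) • w) {N : ℕ} (hN : (d ^ N) w = 0) :
    weyl e d w = stringSum e d N c w := by
  have exp_e_exp_d := (exp_e_exp_d_apply he hd hN).trans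
    (rel.exp_neg_d_stringSum_apply hd hw hN).symm
  rw [weyl, mul_assoc, Module.End.mul_apply, Module.End.mul_apply, exp_e_exp_d,
    ← Module.End.mul_apply, IsNilpotent.exp_mul_exp_neg_self hd, Module.End.one_apply]

lemma weyl_divPow_e_apply (rel : IsSl2Relation h e d) (he : IsNilpotent e) (hd : IsNilpotent d)
    (hw : h w = -(c : ℚ) • w) {N : ℕ} (hN : (d ^ N) w = 0) (n : ℕ) :
    weyl e d (divPow e n w) = (-1 : ℚ) ^ n • stringSum e d N (c - n) w := by
  have weyl_divPow : SemiconjBy (weyl e d) (divPow e n) (divPow d n) := by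
    simp only [divPow_natCast]
    exact ((rel.semiconjBy_weyl_e he hd).pow_right n).smul_right _
  rw [← Module.End.mul_apply, weyl_divPow.eq, Module.End.mul_apply, rel.weyl_apply he hd hw hN,
    rel.divPow_d_stringSum_apply hw hN]

/-- The inverse of `weyl e d` is `weyl (-d) (-e)`, which differs from `weyl d e = weyl e d` by a
sign on every weight vector. -/
lemma weyl_weyl_apply (rel : IsSl2Relation h e d) (he : IsNilpotent e) (hd : IsNilpotent d)
    (hw : h w = -(c : ℚ) • w) : weyl e d (weyl e d w) = (-1 : ℚ) ^ c • w := by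
  obtain ⟨N, hN⟩ := id he
  set u := weyl e d w
  have hu : (-h) u = -(c : ℚ) • u := by
    have := LinearMap.congr_fun (rel.semiconjBy_weyl_h he hd).eq w
    rw [Module.End.mul_apply, Module.End.mul_apply, hw, map_smul] at this
    exact this.symm
  have weyl_neg_u : weyl (-d) (-e) u = w := by
    have weyl_eq : weyl (-d) (-e) * weyl e d = 1 := by
      have := weyl_mul_weyl_neg he.neg hd.neg
      rwa [neg_neg, neg_neg, ← rel.neg.weyl_comm he.neg hd.neg] at this
    simpa using LinearMap.congr_fun weyl_eq w
  have weyl_neg_u_eq : weyl (-d) (-e) u = (-1 : ℚ) ^ c • weyl e d u := by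
    rw [← rel.weyl_comm he hd, rel.symm.weyl_apply hd he hu (N := N) (by simp [hN]),
      rel.symm.neg.weyl_apply hd.neg he.neg hu (N := N) (by rw [neg_pow, hN]; simp),
      stringSum_apply, stringSum_apply, Finset.smul_sum]
    refine Finset.sum_congr rfl fun j _ => ?_
    rw [divPow_neg_left, divPow_neg_left, LinearMap.smul_apply, LinearMap.smul_apply, map_smul,
      smul_smul, zpow_add₀ (by norm_num), mul_assoc, ← mul_zpow]
    simp
  rw [← weyl_neg_u, weyl_neg_u_eq, smul_smul, ← mul_zpow]
  simp

end IsSl2Relation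

end Module

end Weyl

section StableRange

lemma pow_dvd_mul_pow_of_ad_pow_eq_zero {A : Type*} [Ring A] [Algebra ℚ A] {d a : A} {N : ℕ}
    (hN : (LieAlgebra.ad ℚ A d ^ N) a = 0) (n : ℕ) : d ^ n ∣ a * d ^ (n + N) := by
  induction N generalizing a n with
  | zero => simp_all
  | succ N ih =>
    have dvd_lie (n : ℕ) : d ^ n ∣ ⁅d, a⁆ * d ^ (n + N) := ih (by simpa [pow_succ] using hN) n
    induction n with
    | zero => simp
    | succ n ihn =>
      have : a * d ^ (n + 1 + (N + 1)) =
          d * (a * d ^ (n + (N + 1))) - ⁅d, a⁆ * d ^ (n + 1 + N) := by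
        rw [Ring.lie_def, show n + 1 + (N + 1) = (n + 1 + N) + 1 by ring, pow_succ' d (n + 1 + N),
          show n + (N + 1) = n + 1 + N by ring]
        noncomm_ring
      rw [this]
      exact dvd_sub (pow_succ' d n ▸ mul_dvd_mul_left d ihn) (dvd_lie (n + 1))

variable {M : Type*} [AddCommGroup M] [Module ℚ M] {d a : Module.End ℚ M}

lemma apply_mem_stableRange {N : ℕ} (hN : (LieAlgebra.ad ℚ (Module.End ℚ M) d ^ N) a = 0) {F : M}
    (hF : F ∈ stableRange d) : a F ∈ stableRange d := by
  refine mem_stableRange.mpr fun n => ?_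
  obtain ⟨G, rfl⟩ := mem_stableRange.mp hF (n + N)
  obtain ⟨q, hq⟩ := pow_dvd_mul_pow_of_ad_pow_eq_zero hN n
  exact ⟨q G, (LinearMap.congr_fun hq G).symm⟩

lemma pow_apply_mem_stableRange {F : M} (hF : F ∈ stableRange d) (n : ℕ) :
    (d ^ n) F ∈ stableRange d :=
  apply_mem_stableRange (N := 1) (by simp [Ring.lie_def, (Commute.self_pow d n).eq]) hF

end StableRange

section Operators

/-- Multiplication by the variable `x_k`, for `k : ℕ+`. -/
def mulX (k : ℕ+) : Module.End ℚ Poly := LinearMap.mulLeft ℚ (X k)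

lemma mulX_apply (k : ℕ+) (F : Poly) : mulX k F = X k * F := rfl

lemma lie_apply (A B : Module.End ℚ Poly) (F : Poly) : ⁅A, B⁆ F = A (B F) - B (A F) := rfl

-- The general `smul_lie` and `lie_smul` hold here, but cannot be used for rewriting.
lemma smul_lie_end (c : ℚ) (A B : Module.End ℚ Poly) : ⁅c • A, B⁆ = c • ⁅A, B⁆ := smul_lie c A B

lemma lie_smul_end (c : ℚ) (A B : Module.End ℚ Poly) : ⁅A, c • B⁆ = c • ⁅A, B⁆ := lie_smul c A B

lemma end_ext {A B : Module.End ℚ Poly} (one : A 1 = B 1)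
    (lie_mulX : ∀ k, ⁅A, mulX k⁆ = ⁅B, mulX k⁆) : A = B := by
  have sub_X_mul (k : ℕ+) (F : Poly) : (A - B) (X k * F) = X k * (A - B) F := by
    have : ⁅A - B, mulX k⁆ F = 0 := by rw [sub_lie, lie_mulX, sub_self, LinearMap.zero_apply]
    rwa [lie_apply, mulX_apply, mulX_apply, sub_eq_zero] at this
  rw [← sub_eq_zero]
  refine LinearMap.ext fun F => ?_
  induction F using MvPolynomial.induction_on with
  | C a => rw [← mul_one (C a), ← smul_eq_C_mul, map_smul]; simp [one]
  | add F G hF hG => rw [map_add, hF, hG]; simp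
  | mul_X F k hF => rw [mul_comm, sub_X_mul, hF]; simp

lemma x_pnat (k : ℕ+) : x (k : ℕ) = X k := by simp [x]

lemma pd_one (n : ℕ+) : pd n 1 = 0 := by simp [pd]

lemma pd_X_mul (n k : ℕ+) (F : Poly) :
    pd n (X k * F) = (if n = k then F else 0) + X k * pd n F := by
  simp only [pd, Derivation.coeFn_coe, Derivation.leibniz, pderiv_X, smul_eq_mul, Pi.single_apply]
  split_ifs <;> simp_all [add_comm]

lemma lie_pd_mulX (n k : ℕ+) : ⁅pd n, mulX k⁆ = if n = k then 1 else 0 := by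
  refine LinearMap.ext fun F => ?_
  rw [lie_apply, mulX_apply, mulX_apply, pd_X_mul]
  split_ifs <;> simp

/-- The locally finite sum `∑ A_n ∂_n` of operators. -/
def sumPd (A : ℕ+ → Module.End ℚ Poly) : Module.End ℚ Poly :=
  have finite_support (F : Poly) : (Function.support fun n : ℕ+ => A n (pd n F)).Finite :=
    F.vars.finite_toSet.subset fun n hn => by
      by_contra h
      exact hn (by simp only [pd_eq_zero h, map_zero])
  { toFun F := ∑ᶠ n : ℕ+, A n (pd n F)
    map_add' F G := by
      simp only [map_add]
      exact finsum_add_distrib (finite_support F) (finite_support G)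
    map_smul' a F := by
      simp only [map_smul, RingHom.id_apply]
      exact (smul_finsum' a (finite_support F)).symm }

lemma sumPd_apply_eq_sum (A : ℕ+ → Module.End ℚ Poly) (F : Poly) {s : Finset ℕ+}
    (hs : ∀ n ∉ s, pd n F = 0) : sumPd A F = ∑ n ∈ s, A n (pd n F) := by
  refine finsum_eq_sum_of_support_subset _ fun n hn => ?_
  by_contra h
  exact hn (by simp only [hs n h, map_zero])

lemma sumPd_apply_eq_sum_of_vars_subset (A : ℕ+ → Module.End ℚ Poly) (F : Poly) {s : Finset ℕ+}
    (hs : F.vars ⊆ s) : sumPd A F = ∑ n ∈ s, A n (pd n F) :=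
  sumPd_apply_eq_sum A F fun _ hn => pd_eq_zero fun h => hn (hs h)

lemma sumPd_one (A : ℕ+ → Module.End ℚ Poly) : sumPd A 1 = 0 := by
  rw [sumPd_apply_eq_sum_of_vars_subset A 1 (s := ∅) (by simp), Finset.sum_empty]

lemma sumPd_smul (c : ℚ) (A : ℕ+ → Module.End ℚ Poly) :
    (sumPd fun n => c • A n) = c • sumPd A := by
  refine LinearMap.ext fun F => ?_
  rw [LinearMap.smul_apply, sumPd_apply_eq_sum_of_vars_subset _ _ subset_rfl,
    sumPd_apply_eq_sum_of_vars_subset _ _ subset_rfl, Finset.smul_sum]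
  rfl

lemma lie_sumPd_mulX (A : ℕ+ → Module.End ℚ Poly) (k : ℕ+) :
    ⁅sumPd A, mulX k⁆ = A k + sumPd fun n => ⁅A n, mulX k⁆ := by
  refine LinearMap.ext fun F => ?_
  have vars_subset : (X k * F).vars ⊆ insert k F.vars :=
    (vars_mul _ _).trans (by rw [vars_X, Finset.insert_eq])
  rw [lie_apply, LinearMap.add_apply, mulX_apply, mulX_apply,
    sumPd_apply_eq_sum_of_vars_subset _ _ vars_subset,
    sumPd_apply_eq_sum_of_vars_subset _ _ (Finset.subset_insert k _),
    sumPd_apply_eq_sum_of_vars_subset _ _ (Finset.subset_insert k _)]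
  simp only [pd_X_mul, map_add, Finset.sum_add_distrib, lie_apply, mulX_apply,
    Finset.sum_sub_distrib, Finset.mul_sum, apply_ite (A _), map_zero, Finset.sum_ite_eq',
    Finset.mem_insert_self, if_true, add_sub_assoc]

/-- The operators realizing the Poisson brackets of the monomials `yⁱ tᵐ`, see
`lie_hamOp_hamOp`. They act on `exp (∑ aₙ n! xₙ)` by multiplication with the image of
`(tᵐ φ(t)ⁱ)'`, where `φ = ∑ aₙ tⁿ`, under the linear map with `tⁿ ↦ n! xₙ`. The operators `D` and
`h` are `hamOp 2 0` and `hamOp 1 1` up to multiples of `∂₁` and `1`. For `i + m ≤ 1` the definition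
involves the junk value `x 0`. -/
def hamOp : ℕ → ℕ → Module.End ℚ Poly
  | 0, m => (m.factorial : ℚ) • LinearMap.mulLeft ℚ (x (m - 1))
  | i + 1, m => sumPd fun n => (1 / (n : ℕ).factorial : ℚ) • hamOp i (m + n)

lemma hamOp_zero_succ (k : ℕ+) : hamOp 0 (k + 1) = ((k + 1 : ℕ).factorial : ℚ) • mulX k := by
  simp [hamOp, x_pnat, mulX]

lemma hamOp_succ (i m : ℕ) :
    hamOp (i + 1) m = sumPd fun n => (1 / (n : ℕ).factorial : ℚ) • hamOp i (m + n) := rfl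

lemma hamOp_succ_one (i m : ℕ) : hamOp (i + 1) m 1 = 0 := sumPd_one _

lemma lie_hamOp_zero_mulX (m : ℕ) (k : ℕ+) : ⁅hamOp 0 m, mulX k⁆ = 0 := by
  refine LinearMap.ext fun F => ?_
  simp [mulX_apply, hamOp, mul_left_comm]

lemma lie_hamOp_mulX (i m : ℕ) (k : ℕ+) :
    ⁅hamOp i m, mulX k⁆ = (i / (k : ℕ).factorial : ℚ) • hamOp (i - 1) (m + k) := by
  induction i generalizing m with
  | zero => simp [lie_hamOp_zero_mulX]
  | succ i ih =>
    have sum_lie : (sumPd fun n => ⁅(1 / (n : ℕ).factorial : ℚ) • hamOp i (m + n), mulX k⁆) =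
        (i / (k : ℕ).factorial : ℚ) • hamOp i (m + k) := by
      cases i with
      | zero => simpa [smul_lie_end, lie_hamOp_zero_mulX] using sumPd_smul 0 fun _ => 0
      | succ i =>
        rw [hamOp_succ, ← sumPd_smul]
        congr 1
        funext n
        rw [smul_lie_end, ih, smul_comm, add_right_comm, Nat.add_sub_cancel]
    rw [hamOp_succ, lie_sumPd_mulX, sum_lie, ← add_smul]
    congr 1
    push_cast; ring

lemma lie_hamOp_hamOp_zero {m j l : ℕ} (hm : 2 ≤ m) :
    ⁅hamOp j l, hamOp 0 m⁆ = (j * m : ℚ) • hamOp (j - 1) (l + m - 1) := by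
  obtain ⟨k, rfl⟩ : ∃ k : ℕ+, m = k + 1 := ⟨⟨m - 1, by lia⟩, by rw [PNat.mk_coe]; lia⟩
  rw [hamOp_zero_succ, lie_smul_end, lie_hamOp_mulX, smul_smul, ← add_assoc, Nat.add_sub_cancel]
  congr 1
  rw [Nat.factorial_succ]
  push_cast
  field_simp

/-- Both sides are determined by their brackets with the `mulX k`, which the Jacobi identity reduces
to smaller `i + j`. -/
lemma lie_hamOp_hamOp (i j : ℕ) {m l : ℕ} (him : 2 ≤ i + m) (hjl : 2 ≤ j + l) :
    ⁅hamOp i m, hamOp j l⁆ = (i * l - j * m : ℚ) • hamOp (i + j - 1) (m + l - 1) := by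
  induction hN : i + j using Nat.strong_induction_on generalizing i j m l with
  | _ N ih =>
  subst hN
  rcases i with _ | i
  · rw [← lie_skew, lie_hamOp_hamOp_zero (by lia), add_comm l m, zero_add, Nat.cast_zero]
    module
  rcases j with _ | j
  · rw [lie_hamOp_hamOp_zero (by lia), add_zero, Nat.cast_zero, zero_mul, sub_zero]
  have index_eq : i + 1 + (j + 1) - 1 = i + j + 1 := by lia
  refine end_ext ?_ fun k => ?_
  · simp [hamOp_succ_one, index_eq]
  have hk := k.pos
  rw [lie_lie, lie_hamOp_mulX, lie_hamOp_mulX, lie_smul_end, lie_smul_end, Nat.add_sub_cancel,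
    Nat.add_sub_cancel, ih (i + 1 + j) (by lia) (i + 1) j him (by lia) rfl,
    ih (j + 1 + i) (by lia) (j + 1) i hjl (by lia) rfl, index_eq, smul_lie_end, lie_hamOp_mulX,
    Nat.add_sub_cancel, show i + 1 + j - 1 = i + j by lia, show j + 1 + i - 1 = i + j by lia,
    show l + (m + k) - 1 = m + (l + k) - 1 by lia, smul_smul, smul_smul, smul_smul, ← sub_smul]
  rcases Nat.eq_zero_or_pos (m + l) with h0 | h0
  · obtain ⟨rfl, rfl⟩ : m = 0 ∧ l = 0 := by lia
    simp only [Nat.cast_zero, mul_zero, sub_zero, zero_mul, zero_smul]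
    convert zero_smul ℚ (hamOp (i + j) (0 + (0 + k) - 1)) using 2
    push_cast
    ring
  · rw [show m + l - 1 + k = m + (l + k) - 1 by lia]
    congr 1
    push_cast
    ring

lemma lie_pd_hamOp {i m : ℕ} (him : 3 ≤ i + m) : ⁅pd 1, hamOp i m⁆ = 0 := by
  induction i generalizing m with
  | zero =>
    obtain ⟨k, rfl⟩ : ∃ k : ℕ+, m = k + 1 := ⟨⟨m - 1, by lia⟩, by rw [PNat.mk_coe]; lia⟩
    have one_ne : (1 : ℕ+) ≠ k := by rintro rfl; simp at him
    rw [hamOp_zero_succ, lie_smul_end, lie_pd_mulX, if_neg one_ne, smul_zero]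
  | succ i ih =>
    refine end_ext (by simp [hamOp_succ_one, pd_one]) fun k => ?_
    have hk := k.pos
    rw [lie_lie, lie_hamOp_mulX, lie_smul_end, Nat.add_sub_cancel, ih (by lia), lie_pd_mulX,
      zero_lie]
    split_ifs <;> simp [Ring.lie_def]

lemma lie_pd_hamOp_one_one : ⁅pd 1, hamOp 1 1⁆ = (2 : ℚ) • pd 1 := by
  refine end_ext (by simp [hamOp_succ_one, pd_one]) fun k => ?_
  rw [lie_lie, lie_hamOp_mulX, lie_smul_end, Nat.sub_self, add_comm 1, hamOp_zero_succ,
    lie_smul_end, smul_lie_end, lie_pd_mulX]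
  split_ifs with h
  · subst h
    simp [Ring.lie_def]
  · simp

lemma hOp_eq (g : ℕ) : hOp g = -(g : ℚ) • 1 + hamOp 1 1 := by
  unfold hOp
  congr 1
  refine LinearMap.ext fun F => finsum_congr fun n => ?_
  change ((n : ℚ) + 1) • x n * _ = ((1 / (n : ℕ).factorial : ℚ) • hamOp 0 (1 + n)) (pd n F)
  rw [add_comm 1, hamOp_zero_succ, smul_smul, LinearMap.smul_apply, mulX_apply, x_pnat,
    smul_mul_assoc, Nat.factorial_succ]
  congr 1
  push_cast
  field_simp

lemma hamOp_two_zero : hamOp 2 0 =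
    diffOp₂ fun p => (Nat.choose (p.1 + p.2) p.1 : ℚ) • x ((p.1 : ℕ) + p.2 - 1) := by
  refine LinearMap.ext fun F => ?_
  change _ = ∑ᶠ p : ℕ+ × ℕ+, _
  rw [finsum_eq_sum_of_support_subset (s := F.vars ×ˢ F.vars), Finset.sum_product_right,
    hamOp_succ, sumPd_apply_eq_sum_of_vars_subset _ _ subset_rfl]
  · refine Finset.sum_congr rfl fun n _ => ?_
    rw [hamOp_succ, LinearMap.smul_apply, sumPd_apply_eq_sum (s := F.vars) _ _ fun i hi => by
      rw [pd_comm, pd_eq_zero hi, map_zero], Finset.smul_sum]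
    refine Finset.sum_congr rfl fun m _ => ?_
    simp only [hamOp, LinearMap.smul_apply, LinearMap.mulLeft_apply, smul_smul, smul_mul_assoc]
    rw [zero_add, add_comm (n : ℕ), Nat.cast_add_choose]
    congr 1
    field_simp
  · intro p hp
    contrapose! hp
    rw [Finset.mem_coe, Finset.mem_product, not_and_or] at hp
    rw [Function.notMem_support]
    rcases hp with h | h
    · simp only [pd_comm p.1, pd_eq_zero h, map_zero, mul_zero]
    · simp only [pd_eq_zero h, map_zero, mul_zero]

lemma D_eq (g : ℕ) : D g = -(g : ℚ) • pd 1 + (1 / 2 : ℚ) • hamOp 2 0 := by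
  rw [hamOp_two_zero, D]

lemma lie_D (g : ℕ) (A : Module.End ℚ Poly) :
    ⁅D g, A⁆ = -(g : ℚ) • ⁅pd 1, A⁆ + (1 / 2 : ℚ) • ⁅hamOp 2 0, A⁆ := by
  rw [D_eq, add_lie, smul_lie_end, smul_lie_end]

lemma lie_hOp (g : ℕ) (A : Module.End ℚ Poly) : ⁅hOp g, A⁆ = ⁅hamOp 1 1, A⁆ := by
  rw [hOp_eq, add_lie, smul_lie_end, show ⁅(1 : Module.End ℚ Poly), A⁆ = 0 by simp [Ring.lie_def],
    smul_zero, zero_add]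

lemma lie_D_mulX_one (g : ℕ) : ⁅D g, mulX 1⁆ = hOp g := by
  rw [lie_D, lie_hamOp_mulX, lie_pd_mulX, hOp_eq, smul_smul]
  simp

lemma lie_D_mulX (g : ℕ) {k : ℕ+} (hk : k ≠ 1) :
    ⁅D g, mulX k⁆ = (1 / (k : ℕ).factorial : ℚ) • hamOp 1 k := by
  rw [lie_D, lie_hamOp_mulX, lie_pd_mulX, if_neg hk.symm, smul_zero, zero_add, smul_smul, zero_add]
  congr 1
  push_cast
  ring

lemma lie_hOp_D (g : ℕ) : ⁅hOp g, D g⁆ = (-2 : ℚ) • D g := by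
  rw [lie_hOp, ← lie_skew, lie_D, lie_pd_hamOp_one_one, lie_hamOp_hamOp 2 1 le_rfl le_rfl, D_eq]
  norm_num
  module

lemma lie_hOp_mulX (g : ℕ) (k : ℕ+) : ⁅hOp g, mulX k⁆ = (k + 1 : ℚ) • mulX k := by
  rw [lie_hOp, lie_hamOp_mulX, Nat.sub_self, add_comm 1, hamOp_zero_succ, smul_smul,
    Nat.factorial_succ]
  congr 1
  push_cast
  field_simp

lemma lie_D_hamOp (g : ℕ) {j l : ℕ} (hjl : 3 ≤ j + l) :
    ⁅D g, hamOp j l⁆ = (l : ℚ) • hamOp (j + 1) (l - 1) := by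
  rw [lie_D, lie_pd_hamOp hjl, lie_hamOp_hamOp 2 j le_rfl (by lia), smul_zero, zero_add, smul_smul,
    show 2 + j - 1 = j + 1 by lia, zero_add]
  congr 1
  push_cast
  ring

lemma hOp_one (g : ℕ) : hOp g 1 = -(g : ℚ) • 1 := by
  rw [hOp_eq]
  simp [hamOp_succ_one]

lemma D_one (g : ℕ) : D g 1 = 0 := by
  rw [D_eq]
  simp [hamOp_succ_one, pd_one]

lemma eOp_eq : eOp = mulX 1 := by rw [eOp, mulX, ← x_pnat, PNat.one_coe]

lemma isSl2Relation (g : ℕ) : IsSl2Relation (hOp g) eOp (D g) where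
  lie_d_e := by rw [eOp_eq, lie_D_mulX_one]
  lie_h_e := by
    rw [eOp_eq, lie_hOp_mulX, PNat.one_coe, Nat.cast_one, one_add_one_eq_two, ofNat_smul_eq_nsmul]
  lie_h_d := by
    rw [lie_hOp_D]
    module

end Operators

section Stability

lemma ad_pow_hamOp (g : ℕ) {j l : ℕ} (hjl : 3 ≤ j + l) :
    (LieAlgebra.ad ℚ (Module.End ℚ Poly) (D g) ^ (l + 1)) (hamOp j l) = 0 := by
  induction l generalizing j with
  | zero => simp [LieAlgebra.ad_apply, lie_D_hamOp g hjl]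
  | succ l ih =>
    rw [pow_succ, Module.End.mul_apply, LieAlgebra.ad_apply, lie_D_hamOp g hjl, map_smul,
      Nat.add_sub_cancel, ih (by lia), smul_zero]

lemma mulX_mem_stableRange (g : ℕ) (k : ℕ+) {F : Poly} (hF : F ∈ stableRange (D g)) :
    X k * F ∈ stableRange (D g) := by
  rw [← mulX_apply]
  by_cases hk : k = 1
  · subst hk
    refine apply_mem_stableRange (N := 3) ?_ hF
    simp [pow_succ, LieAlgebra.ad_apply, lie_D_mulX_one, ← lie_skew (D g) (hOp g), lie_hOp_D,
      lie_smul_end]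
  · refine apply_mem_stableRange (N := k + 2) ?_ hF
    have one_lt : 1 < (k : ℕ) := PNat.coe_lt_coe 1 k |>.mpr (one_lt_iff_ne_one.mpr hk)
    rw [pow_succ, Module.End.mul_apply, LieAlgebra.ad_apply, lie_D_mulX g hk, map_smul,
      ad_pow_hamOp g (by lia), smul_zero]

lemma mul_mem_stableRange (g : ℕ) (F : Poly) {G : Poly} (hG : G ∈ stableRange (D g)) :
    F * G ∈ stableRange (D g) := by
  induction F using MvPolynomial.induction_on with
  | C a => rw [← smul_eq_C_mul]; exact Submodule.smul_mem _ a hG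
  | add F F' hF hF' => rw [add_mul]; exact Submodule.add_mem _ hF hF'
  | mul_X F k hF => rw [mul_right_comm, mul_comm _ (X k)]; exact mulX_mem_stableRange g k hF

end Stability

section Products

variable {ι : Type*}

lemma hOp_x_mul (g : ℕ) {k : ℕ} (hk : 0 < k) (F : Poly) :
    hOp g (x k * F) = x k * hOp g F + (k + 1 : ℚ) • (x k * F) := by
  lift k to ℕ+ using hk
  have lie := LinearMap.congr_fun (lie_hOp_mulX g k) F
  rwa [lie_apply, sub_eq_iff_eq_add', mulX_apply, LinearMap.smul_apply, mulX_apply, mulX_apply,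
    ← x_pnat] at lie

lemma hOp_prod (g : ℕ) {ν : ι → ℕ} {s : Finset ι} (hν : ∀ i ∈ s, 0 < ν i) :
    hOp g (∏ i ∈ s, x (ν i)) = -((g - ∑ i ∈ s, ν i - s.card : ℤ) : ℚ) • ∏ i ∈ s, x (ν i) := by
  classical
  induction s using Finset.induction_on with
  | empty => simpa using hOp_one g
  | insert a s ha ih =>
    rw [Finset.prod_insert ha, hOp_x_mul g (hν a (by simp)), ih fun i hi => hν i (by simp [hi]),
      mul_smul_comm, ← add_smul, Finset.sum_insert ha, Finset.card_insert_of_notMem ha]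
    congr 1
    push_cast
    ring

lemma hamOp_one_x_mul (k : ℕ) {l : ℕ} (hl : 0 < l) (F : Poly) :
    hamOp 1 k (x l * F) =
      ((k + l).factorial / l.factorial : ℚ) • (x (k + l - 1) * F) + x l * hamOp 1 k F := by
  lift l to ℕ+ using hl
  have lie := LinearMap.congr_fun (lie_hamOp_mulX 1 k l) F
  rw [lie_apply, sub_eq_iff_eq_add, mulX_apply, mulX_apply, ← x_pnat] at lie
  rw [lie, Nat.sub_self, hamOp, LinearMap.smul_apply, LinearMap.smul_apply,
    LinearMap.mulLeft_apply, smul_smul, Nat.cast_one, one_div_mul_eq_div]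

variable [DecidableEq ι]

lemma hamOp_one_prod (k : ℕ) {ν : ι → ℕ} {s : Finset ι} (hν : ∀ i ∈ s, 0 < ν i) :
    hamOp 1 k (∏ i ∈ s, x (ν i)) = ∑ j ∈ s, ((k + ν j).factorial / (ν j).factorial : ℚ) •
      (x (k + ν j - 1) * ∏ i ∈ s.erase j, x (ν i)) := by
  induction s using Finset.induction_on with
  | empty => simp [hamOp_succ_one]
  | insert a s ha ih =>
    rw [Finset.prod_insert ha, hamOp_one_x_mul k (hν a (by simp)),
      ih fun i hi => hν i (by simp [hi]), Finset.sum_insert ha, Finset.erase_insert ha,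
      Finset.mul_sum]
    congr 1
    refine Finset.sum_congr rfl fun j hj => ?_
    have ne : a ≠ j := fun h => ha (h ▸ hj)
    rw [Finset.erase_insert_of_ne ne, Finset.prod_insert (by simp [ha]), mul_smul_comm,
      mul_left_comm]

/-- The exponents `ν` with `ν i` replaced by `ν i + ν j - 1`. The operator `D` replaces pairs of
factors `x_{ν i} x_{ν j}` by `x_{ν i + ν j - 1}`; in the resulting product the index `j` is omitted,
not removed from `ι`. -/
def merge (ν : ι → ℕ) (i j : ι) : ι → ℕ := Function.update ν i (ν i + ν j - 1)

lemma merge_self (ν : ι → ℕ) (i j : ι) : merge ν i j i = ν i + ν j - 1 := by simp [merge]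

lemma merge_of_ne (ν : ι → ℕ) {i j k : ι} (h : k ≠ i) : merge ν i j k = ν k := by simp [merge, h]

lemma one_lt_merge {ν : ι → ℕ} {s : Finset ι} (hν : ∀ i ∈ s, 1 < ν i) {i j : ι} (hi : i ∈ s)
    (hj : j ∈ s) : ∀ k ∈ s.erase j, 1 < merge ν i j k := by
  intro k hk
  rcases eq_or_ne k i with rfl | h
  · have hi := hν k hi
    have hj := hν j hj
    rw [merge_self]
    lia
  · rw [merge_of_ne ν h]
    exact hν k (Finset.mem_of_mem_erase hk)

lemma sum_merge {ν : ι → ℕ} {s : Finset ι} {i j : ι} (hi : i ∈ s) (hj : j ∈ s) (hij : i ≠ j)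
    (h : 0 < ν i) : ∑ k ∈ s.erase j, merge ν i j k + 1 = ∑ k ∈ s, ν k := by
  have hi' : i ∈ s.erase j := Finset.mem_erase.mpr ⟨hij, hi⟩
  rw [← Finset.add_sum_erase _ _ hj, ← Finset.add_sum_erase _ _ hi', ← Finset.add_sum_erase _ _ hi',
    merge_self, Finset.sum_congr rfl fun k hk => merge_of_ne ν (Finset.ne_of_mem_erase hk)]
  lia

lemma prod_merge {M : Type*} [CommMonoid M] (f : ℕ → M) {ν : ι → ℕ} {s : Finset ι} {i : ι} (j : ι)
    (hi : i ∈ s) :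
    ∏ k ∈ s, f (merge ν i j k) = f (ν i + ν j - 1) * ∏ k ∈ s.erase i, f (ν k) := by
  rw [← Finset.mul_prod_erase _ _ hi, merge_self]
  congr 1
  exact Finset.prod_congr rfl fun k hk => by rw [merge_of_ne ν (Finset.ne_of_mem_erase hk)]

lemma sum_sum_erase_insert {M : Type*} [AddCommMonoid M] {a : ι} {s : Finset ι} (ha : a ∉ s)
    (f : ι → ι → M) : ∑ i ∈ insert a s, ∑ j ∈ (insert a s).erase i, f i j =
      ∑ i ∈ s, (f a i + f i a) + ∑ i ∈ s, ∑ j ∈ s.erase i, f i j := by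
  rw [Finset.sum_insert ha, Finset.erase_insert ha, Finset.sum_add_distrib, add_assoc]
  congr 1
  rw [← Finset.sum_add_distrib]
  refine Finset.sum_congr rfl fun i hi => ?_
  have hai : a ≠ i := fun h => ha (h ▸ hi)
  rw [Finset.erase_insert_of_ne hai,
    Finset.sum_insert fun h => ha (Finset.mem_of_mem_erase h)]

lemma D_x_mul (g : ℕ) {k : ℕ} (hk : 1 < k) (F : Poly) :
    D g (x k * F) = (1 / k.factorial : ℚ) • hamOp 1 k F + x k * D g F := by
  lift k to ℕ+ using one_pos.trans hk
  have lie := LinearMap.congr_fun (lie_D_mulX g (k := k) (by rintro rfl; simp at hk)) F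
  rwa [lie_apply, sub_eq_iff_eq_add, mulX_apply, mulX_apply, ← x_pnat] at lie

lemma D_prod (g : ℕ) {ν : ι → ℕ} {s : Finset ι} (hν : ∀ i ∈ s, 1 < ν i) :
    D g (∏ i ∈ s, x (ν i)) = ∑ i ∈ s, ∑ j ∈ s.erase i,
      ((ν i + ν j).choose (ν i) / 2 : ℚ) • ∏ k ∈ s.erase j, x (merge ν i j k) := by
  induction s using Finset.induction_on with
  | empty => simp [D_one]
  | insert a s ha ih =>
    have hs : ∀ i ∈ s, 1 < ν i := fun i hi => hν i (by simp [hi])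
    have ne_a : ∀ i ∈ s, i ≠ a := fun i hi h => ha (h ▸ hi)
    rw [Finset.prod_insert ha, D_x_mul g (hν a (by simp)), ih hs,
      hamOp_one_prod _ fun i hi => one_pos.trans (hs i hi), sum_sum_erase_insert ha,
      Finset.smul_sum, Finset.mul_sum]
    congr 1
    · refine Finset.sum_congr rfl fun j hj => ?_
      rw [prod_merge x j (by simp [(ne_a j hj).symm]), prod_merge x a (by simp [ne_a j hj, hj]),
        Finset.erase_right_comm, Finset.erase_insert ha, add_comm (ν j), ← add_smul, smul_smul]
      congr 1
      rw [Nat.cast_add_choose, add_comm (ν a), Nat.cast_add_choose]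
      field_simp
      ring
    · refine Finset.sum_congr rfl fun i hi => ?_
      rw [Finset.mul_sum]
      refine Finset.sum_congr rfl fun j hj => ?_
      have hj' := ne_a j (Finset.mem_of_mem_erase hj)
      rw [Finset.erase_insert_of_ne hj'.symm, Finset.prod_insert (by simp [ha]),
        merge_of_ne ν (ne_a i hi).symm, mul_smul_comm]

end Products

lemma D_pow_prod_eq_zero {ι : Type*} (g : ℕ) {N : ℕ} {ν : ι → ℕ} {s : Finset ι}
    (hν : ∀ i ∈ s, 1 < ν i) (hN : 0 < N) (h : s.card ≤ N) : (D g ^ N) (∏ i ∈ s, x (ν i)) = 0 := by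
  classical
  induction N generalizing ν s with
  | zero => lia
  | succ N ih =>
    simp only [pow_succ, Module.End.mul_apply, D_prod g hν, map_sum, map_smul]
    refine Finset.sum_eq_zero fun i hi => Finset.sum_eq_zero fun j hj => ?_
    have hjs := Finset.mem_of_mem_erase hj
    have card_erase := Finset.card_erase_of_mem hjs
    have : 0 < (s.erase j).card :=
      Finset.card_pos.mpr ⟨i, Finset.mem_erase.mpr ⟨(Finset.ne_of_mem_erase hj).symm, hi⟩⟩
    rw [ih (one_lt_merge hν hi hjs) (by lia) (by lia), smul_zero]


section Partitions

section Comap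

variable {α β : Type*} [DecidableEq β] {s : Finset α} {t : Finset β} {r : α → β}

lemma image_filter_mem (hr : s.image r = t) {J : Finset β} (hJ : J ⊆ t) :
    {k ∈ s | r k ∈ J}.image r = J := by
  rw [← Finset.filter_image (p := (· ∈ J)), hr, Finset.filter_mem_eq_inter,
    Finset.inter_eq_right.mpr hJ]

lemma injOn_filter_mem (hr : s.image r = t) (P : Finpartition t) :
    Set.InjOn (fun J => {k ∈ s | r k ∈ J}) (P.parts : Set (Finset β)) := fun J hJ J' hJ' h => by
  rw [← image_filter_mem hr (P.subset hJ), ← image_filter_mem hr (P.subset hJ')]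
  exact congrArg _ h

variable [DecidableEq α]

/-- The partition of `s` into the preimages of the parts of a partition of `t`, under a surjection
`r` of `s` onto `t`. -/
def comapPartition (hr : s.image r = t) (P : Finpartition t) : Finpartition s :=
  Finpartition.ofExistsUnique (P.parts.image fun J => {k ∈ s | r k ∈ J})
    (by
      intro K hK
      obtain ⟨J, -, rfl⟩ := Finset.mem_image.mp hK
      exact Finset.filter_subset _ _)
    (by
      intro k hk
      obtain ⟨J, ⟨hJ, hkJ⟩, unique⟩ :=
        P.existsUnique_mem (a := r k) (hr ▸ Finset.mem_image_of_mem r hk)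
      refine ⟨_, ⟨Finset.mem_image_of_mem _ hJ, Finset.mem_filter.mpr ⟨hk, hkJ⟩⟩, ?_⟩
      rintro K ⟨hK, hkK⟩
      obtain ⟨J', hJ', rfl⟩ := Finset.mem_image.mp hK
      rw [unique J' ⟨hJ', (Finset.mem_filter.mp hkK).2⟩])
    (by
      intro h
      obtain ⟨J, hJ, hJ_empty⟩ := Finset.mem_image.mp h
      refine P.ne_bot hJ ?_
      rw [← image_filter_mem hr (P.subset hJ), hJ_empty, Finset.image_empty, Finset.bot_eq_empty])

lemma card_parts_comapPartition (hr : s.image r = t) (P : Finpartition t) :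
    (comapPartition hr P).parts.card = P.parts.card :=
  Finset.card_image_of_injOn (injOn_filter_mem hr P)

lemma comapPartition_injective (hr : s.image r = t) :
    Function.Injective (comapPartition hr) := by
  intro P Q h
  have parts_eq (P : Finpartition t) : (comapPartition hr P).parts.image (·.image r) = P.parts := by
    change (P.parts.image _).image _ = _
    rw [Finset.image_image]
    conv_rhs => rw [← Finset.image_id (s := P.parts)]
    exact Finset.image_congr fun J hJ => image_filter_mem hr (P.subset hJ)
  exact Finpartition.ext (by rw [← parts_eq P, ← parts_eq Q, h])

end Comap

section Adjoin

variable {ι : Type*} [DecidableEq ι] {s : Finset ι} {i j : ι}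

lemma image_update_id (hi : i ∈ s) (hij : i ≠ j) :
    s.image (Function.update id j i) = s.erase j := by
  ext k
  simp only [Finset.mem_image, Finset.mem_erase]
  constructor
  · rintro ⟨l, hl, rfl⟩
    rcases eq_or_ne l j with rfl | h
    · simpa using ⟨hij, hi⟩
    · simpa [h] using hl
  · rintro ⟨hkj, hk⟩
    exact ⟨k, hk, by simp [hkj]⟩

/-- The partition of `s` obtained from a partition of `s.erase j` by adjoining `j` to the part
of `i`. -/
def adjoinPart (hi : i ∈ s) (hij : i ≠ j) (P : Finpartition (s.erase j)) : Finpartition s :=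
  comapPartition (image_update_id hi hij) P

lemma filter_update_id_mem_of_notMem {J : Finset ι} (hJ : J ⊆ s.erase j) (hi : i ∉ J) :
    {k ∈ s | Function.update id j i k ∈ J} = J := by
  ext k
  have := @hJ k
  by_cases hk : k = j
  · subst hk
    simpa [hi] using this
  · simp_all

lemma filter_update_id_mem_of_mem {J : Finset ι} (hJ : J ⊆ s.erase j) (hj : j ∈ s) (hi : i ∈ J) :
    {k ∈ s | Function.update id j i k ∈ J} = insert j J := by
  ext k
  have := @hJ k
  by_cases hk : k = j
  · subst hk
    simpa [hi] using hj
  · simp_all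

lemma part_adjoinPart (hi : i ∈ s) (hj : j ∈ s) (hij : i ≠ j) (P : Finpartition (s.erase j)) :
    (adjoinPart hi hij P).part i = insert j (P.part i) := by
  have hiP := P.mem_part (Finset.mem_erase.mpr ⟨hij, hi⟩)
  refine Finpartition.part_eq_of_mem _ ?_ (Finset.mem_insert_of_mem hiP)
  rw [← filter_update_id_mem_of_mem (P.part_subset i) hj hiP]
  exact Finset.mem_image_of_mem _ (P.part_mem.mpr (Finset.mem_erase.mpr ⟨hij, hi⟩))

lemma exists_adjoinPart_eq (hi : i ∈ s) (hij : i ≠ j) {P : Finpartition s} (h : j ∈ P.part i) :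
    ∃ Q, adjoinPart hi hij Q = P := by
  have mem_iff {J : Finset ι} (hJ : J ∈ P.parts) : i ∈ J ↔ j ∈ J := by
    refine ⟨fun hiJ => P.part_eq_of_mem hJ hiJ ▸ h, fun hjJ => ?_⟩
    rw [P.eq_of_mem_parts hJ (P.part_mem.mpr hi) hjJ h]
    exact P.mem_part hi
  have filter_erase {J : Finset ι} (hJ : J ∈ P.parts) :
      {k ∈ s | Function.update id j i k ∈ J.erase j} = J := by
    ext k
    have : k ∈ J → k ∈ s := fun hk => P.subset hJ hk
    by_cases hk : k = j
    · subst hk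
      simpa [hij, mem_iff hJ] using this
    · simp_all
  refine ⟨(P.avoid {j}).copy (Finset.sdiff_singleton_eq_erase j s), Finpartition.ext ?_⟩
  ext J
  change J ∈ (P.avoid {j}).parts.image _ ↔ _
  simp only [Finset.mem_image, Finpartition.mem_avoid, Finset.sdiff_singleton_eq_erase]
  constructor
  · rintro ⟨_, ⟨K, hK, -, rfl⟩, rfl⟩
    rwa [filter_erase hK]
  · intro hJ
    refine ⟨_, ⟨J, hJ, fun J_le => ?_, rfl⟩, filter_erase hJ⟩
    obtain ⟨k, hk⟩ := P.nonempty_of_mem_parts hJ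
    obtain rfl : k = j := by simpa using J_le hk
    exact hij (by simpa using J_le ((mem_iff hJ).mpr hk))

end Adjoin

section PartitionSum

variable {k : ℕ} {ν : Fin k → ℕ} {s J : Finset (Fin k)} {i j : Fin k}

/-- The factor `b(J) x_{d(J)}` of a part `J`. -/
def partTerm (ν : Fin k → ℕ) (J : Finset (Fin k)) : Poly := b ν J • x (dIdx ν J)

/-- The sum of `b(J₁) ⋯ b(J_m) x_{d(J₁)} ⋯ x_{d(J_m)}` over the partitions of `s` into `m` parts. -/
def partitionSum (ν : Fin k → ℕ) (s : Finset (Fin k)) (m : ℕ) : Poly :=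
  ∑ P : Finpartition s with P.parts.card = m, ∏ J ∈ P.parts, partTerm ν J

lemma partTerm_merge_of_notMem (hi : i ∉ J) : partTerm (merge ν i j) J = partTerm ν J := by
  have merge_eq {l : Fin k} (hl : l ∈ J) : merge ν i j l = ν l := merge_of_ne ν fun h => hi (h ▸ hl)
  simp only [partTerm, b, dIdx, Finset.sum_congr rfl fun _ hl => merge_eq hl,
    Finset.prod_congr rfl fun _ hl => congrArg (fun n => (n.factorial : ℚ)) (merge_eq hl)]

lemma dIdx_merge (hi : i ∈ J) (hj : j ∉ J) (hνi : 0 < ν i) :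
    dIdx (merge ν i j) J = dIdx ν (insert j J) := by
  have sum_eq := sum_merge (ν := ν) (Finset.mem_insert_of_mem hi) (Finset.mem_insert_self j J)
    (fun h => hj (h ▸ hi)) hνi
  rw [Finset.erase_insert hj] at sum_eq
  rw [dIdx, dIdx, Finset.card_insert_of_notMem hj, ← sum_eq, Nat.add_sub_add_right]

lemma choose_mul_b_merge (hi : i ∈ J) (hj : j ∉ J) (hνi : 0 < ν i) :
    ((ν i + ν j).choose (ν i) : ℚ) * b (merge ν i j) J =
      (ν i + ν j : ℚ) / (∑ l ∈ insert j J, ν l : ℕ) * b ν (insert j J) := by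
  have sum_eq := sum_merge (ν := ν) (Finset.mem_insert_of_mem hi) (Finset.mem_insert_self j J)
    (fun h => hj (h ▸ hi)) hνi
  rw [Finset.erase_insert hj] at sum_eq
  obtain ⟨t, ht⟩ : ∃ t, ν i + ν j = t + 1 := ⟨ν i + ν j - 1, by lia⟩
  have ht' : (ν i + ν j : ℚ) = t + 1 := by exact_mod_cast ht
  have prod_ne : ∏ l ∈ J.erase i, ((ν l).factorial : ℚ) ≠ 0 :=
    Finset.prod_ne_zero_iff.mpr fun l _ => by positivity
  have sum_ne : (∑ l ∈ J, (merge ν i j l : ℚ)) + 1 ≠ 0 := by positivity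
  rw [b, b, ← sum_eq, Nat.factorial_succ, prod_merge (fun n => (n.factorial : ℚ)) j hi,
    Finset.prod_insert hj, ← Finset.mul_prod_erase _ _ hi, Nat.cast_add_choose, ht, ht',
    Nat.add_sub_cancel, Nat.factorial_succ]
  push_cast
  field_simp

lemma partTerm_merge (hi : i ∈ J) (hj : j ∉ J) (hνi : 0 < ν i) :
    ((ν i + ν j).choose (ν i) / 2 : ℚ) • partTerm (merge ν i j) J =
      ((ν i + ν j : ℚ) / 2 / (∑ l ∈ insert j J, ν l : ℕ)) • partTerm ν (insert j J) := by
  rw [partTerm, partTerm, dIdx_merge hi hj hνi, smul_smul, smul_smul, div_mul_eq_mul_div,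
    choose_mul_b_merge hi hj hνi]
  congr 1
  ring

lemma choose_smul_prod_partTerm_merge (hi : i ∈ s) (hj : j ∈ s) (hij : i ≠ j) (hνi : 0 < ν i)
    (P : Finpartition (s.erase j)) :
    ((ν i + ν j).choose (ν i) / 2 : ℚ) • ∏ J ∈ P.parts, partTerm (merge ν i j) J =
      ((ν i + ν j : ℚ) / 2 / (∑ l ∈ (adjoinPart hi hij P).part i, ν l : ℕ)) •
        ∏ J ∈ (adjoinPart hi hij P).parts, partTerm ν J := by
  have hi' : i ∈ s.erase j := Finset.mem_erase.mpr ⟨hij, hi⟩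
  have part_mem := P.part_mem.mpr hi'
  have hj' : j ∉ P.part i := fun h => by simpa using P.part_subset i h
  have prod_eq : ∏ J ∈ (adjoinPart hi hij P).parts, partTerm ν J =
      ∏ J ∈ P.parts, partTerm ν {k ∈ s | Function.update id j i k ∈ J} :=
    Finset.prod_image (injOn_filter_mem (image_update_id hi hij) P)
  have prod_erase_eq : ∏ J ∈ P.parts.erase (P.part i), partTerm (merge ν i j) J =
      ∏ J ∈ P.parts.erase (P.part i), partTerm ν {k ∈ s | Function.update id j i k ∈ J} := by
    refine Finset.prod_congr rfl fun J hJ => ?_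
    have hJ' := Finset.mem_of_mem_erase hJ
    have hiJ : i ∉ J := fun h => Finset.ne_of_mem_erase hJ (P.part_eq_of_mem hJ' h).symm
    rw [partTerm_merge_of_notMem hiJ, filter_update_id_mem_of_notMem (P.subset hJ') hiJ]
  rw [prod_eq, ← Finset.mul_prod_erase _ _ part_mem, ← Finset.mul_prod_erase _ _ part_mem,
    ← smul_mul_assoc, partTerm_merge (P.mem_part hi') hj' hνi, part_adjoinPart hi hj hij,
    filter_update_id_mem_of_mem (P.part_subset i) hj (P.mem_part hi'), prod_erase_eq,
    smul_mul_assoc]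

lemma choose_smul_partitionSum_merge (hi : i ∈ s) (hj : j ∈ s) (hij : i ≠ j) (hνi : 0 < ν i)
    (m : ℕ) :
    ((ν i + ν j).choose (ν i) / 2 : ℚ) • partitionSum (merge ν i j) (s.erase j) m =
      ∑ P : Finpartition s with P.parts.card = m ∧ j ∈ P.part i,
        ((ν i + ν j : ℚ) / 2 / (∑ l ∈ P.part i, ν l : ℕ)) • ∏ J ∈ P.parts, partTerm ν J := by
  rw [partitionSum, Finset.smul_sum]
  refine Finset.sum_bij (fun P _ => adjoinPart hi hij P) (fun P hP => ?_)
    (fun P _ Q _ h => comapPartition_injective _ h) (fun P hP => ?_)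
    fun P _ => choose_smul_prod_partTerm_merge hi hj hij hνi P
  · simp only [Finset.mem_filter_univ] at hP ⊢
    rw [part_adjoinPart hi hj]
    exact ⟨hP ▸ card_parts_comapPartition _ P, Finset.mem_insert_self _ _⟩
  · simp only [Finset.mem_filter_univ] at hP
    obtain ⟨Q, rfl⟩ := exists_adjoinPart_eq hi hij hP.2
    rw [adjoinPart, card_parts_comapPartition] at hP
    exact ⟨Q, (Finset.mem_filter_univ _).mpr hP.1, rfl⟩

lemma sum_sum_erase_add {ι : Type*} [DecidableEq ι] (f : ι → ℚ) (J : Finset ι) :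
    ∑ i ∈ J, ∑ j ∈ J.erase i, (f i + f j) = 2 * (J.card - 1) * ∑ i ∈ J, f i := by
  have sum_erase {i : ι} (hi : i ∈ J) :
      ∑ j ∈ J.erase i, (f i + f j) = (J.card - 2) * f i + ∑ j ∈ J, f j := by
    rw [Finset.sum_erase_eq_sub hi, Finset.sum_add_distrib, Finset.sum_const, nsmul_eq_mul]
    ring
  rw [Finset.sum_congr rfl fun i hi => sum_erase hi, Finset.sum_add_distrib, ← Finset.mul_sum,
    Finset.sum_const, nsmul_eq_mul]
  ring

lemma sum_sum_part_erase (hν : ∀ i ∈ s, 0 < ν i) (P : Finpartition s) :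
    ∑ i ∈ s, ∑ j ∈ (P.part i).erase i, ((ν i + ν j : ℚ) / 2 / (∑ l ∈ P.part i, ν l : ℕ)) =
      s.card - P.parts.card := by
  rw [← P.sum_card_parts, Nat.cast_sum, Finset.card_eq_sum_ones, Nat.cast_sum,
    ← Finset.sum_sub_distrib, Finset.sum_congr P.biUnion_parts.symm fun _ _ => rfl,
    Finset.sum_biUnion P.disjoint]
  refine Finset.sum_congr rfl fun J hJ => ?_
  have sum_pos : 0 < ∑ l ∈ J, ν l :=
    Finset.sum_pos (fun i hi => hν i (P.subset hJ hi)) (P.nonempty_of_mem_parts hJ)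
  rw [Finset.sum_congr rfl fun i hi => by rw [P.part_eq_of_mem hJ hi]]
  simp only [← Finset.sum_div, id_eq]
  rw [sum_sum_erase_add fun i => (ν i : ℚ), ← Nat.cast_sum]
  field_simp
  simp

lemma sum_choose_smul_partitionSum_merge (hν : ∀ i ∈ s, 0 < ν i) (m : ℕ) :
    ∑ i ∈ s, ∑ j ∈ s.erase i,
      ((ν i + ν j).choose (ν i) / 2 : ℚ) • partitionSum (merge ν i j) (s.erase j) m =
        (s.card - m : ℚ) • partitionSum ν s m := by
  have swap {i : Fin k} (hi : i ∈ s) : ∑ j ∈ s.erase i,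
      ((ν i + ν j).choose (ν i) / 2 : ℚ) • partitionSum (merge ν i j) (s.erase j) m =
        ∑ P : Finpartition s with P.parts.card = m, ∑ j ∈ (P.part i).erase i,
          ((ν i + ν j : ℚ) / 2 / (∑ l ∈ P.part i, ν l : ℕ)) • ∏ J ∈ P.parts, partTerm ν J := by
    rw [Finset.sum_congr rfl fun j hj => choose_smul_partitionSum_merge hi
      (Finset.mem_of_mem_erase hj) (Finset.ne_of_mem_erase hj).symm (hν i hi) m]
    refine Finset.sum_comm' fun j P => ?_
    simp only [Finset.mem_filter_univ, Finset.mem_erase]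
    exact ⟨fun h => ⟨⟨h.1.1, h.2.2⟩, h.2.1⟩, fun h => ⟨⟨h.1.1, P.part_subset i h.1.2⟩, h.2, h.1.2⟩⟩
  rw [Finset.sum_congr rfl fun i hi => swap hi, Finset.sum_comm, partitionSum, Finset.smul_sum]
  refine Finset.sum_congr rfl fun P hP => ?_
  simp only [← Finset.sum_smul]
  rw [sum_sum_part_erase hν, (Finset.mem_filter.mp hP).2]

lemma eq_bot_of_card_parts_eq_card {ι : Type*} [DecidableEq ι] {s : Finset ι}
    {P : Finpartition s} (hP : P.parts.card = s.card) : P = ⊥ := by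
  rw [← P.sum_card_parts, Finset.card_eq_sum_ones] at hP
  have one_eq_card := (Finset.sum_eq_sum_iff_of_le fun J hJ =>
    Finset.card_pos.mpr (P.nonempty_of_mem_parts hJ)).mp hP
  refine le_bot_iff.mp fun J hJ => ?_
  obtain ⟨a, rfl⟩ := Finset.card_eq_one.mp (one_eq_card J hJ).symm
  exact ⟨{a}, Finpartition.mem_bot_iff.mpr ⟨a, P.subset hJ (Finset.mem_singleton_self a), rfl⟩,
    le_rfl⟩

lemma partitionSum_card (ν : Fin k → ℕ) (s : Finset (Fin k)) :
    partitionSum ν s s.card = ∏ i ∈ s, x (ν i) := by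
  rw [partitionSum, Finset.sum_eq_single (⊥ : Finpartition s)]
  · rw [Finpartition.parts_bot, Finset.prod_map]
    refine Finset.prod_congr rfl fun i _ => ?_
    have factorial_ne : ((ν i).factorial : ℚ) ≠ 0 := by positivity
    simp [partTerm, b, dIdx, factorial_ne]
  · intro P hP hbot
    exact absurd (eq_bot_of_card_parts_eq_card (Finset.mem_filter.mp hP).2) hbot
  · simp

lemma divPow_D_prod (g : ℕ) {m n : ℕ} (hν : ∀ i ∈ s, 1 < ν i) (h : m + n = s.card) :
    divPow (D g) n (∏ i ∈ s, x (ν i)) = partitionSum ν s m := by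
  induction n generalizing ν s with
  | zero => rw [← partitionSum_card, ← h]; simp
  | succ n ih =>
    have divPow_D (F : Poly) :
        (n + 1 : ℚ) • divPow (D g) (n + 1 : ℕ) F = divPow (D g) n (D g F) := by
      have := LinearMap.congr_fun (mul_divPow (D g) n) F
      rw [(commute_divPow (D g) n).eq] at this
      exact_mod_cast this.symm
    refine smul_right_injective _ (by positivity : (n + 1 : ℚ) ≠ 0) ?_
    dsimp only
    rw [divPow_D, D_prod g hν, map_sum,
      show (n + 1 : ℚ) = s.card - m by rw [← h]; push_cast; ring,
      ← sum_choose_smul_partitionSum_merge fun i hi => one_pos.trans (hν i hi)]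
    refine Finset.sum_congr rfl fun i hi => ?_
    rw [map_sum]
    refine Finset.sum_congr rfl fun j hj => ?_
    have hj' := Finset.mem_of_mem_erase hj
    rw [map_smul, ih (one_lt_merge hν hi hj') (by rw [Finset.card_erase_of_mem hj']; lia)]

end PartitionSum

end Partitions

section FourierSum

variable {k : ℕ} {ν : Fin k → ℕ}

lemma fourierSum_eq_sum (g n : ℕ) (ν : Fin k → ℕ) : fourierSum g n ν =
    ∑ m ∈ Finset.range (k + 1), x₁div (g - n - m - ∑ i, (ν i : ℤ)) *
      partitionSum ν Finset.univ m := by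
  rw [fourierSum, ← Finset.sum_fiberwise_of_maps_to (t := Finset.range (k + 1))
    (g := fun P => P.parts.card)]
  · refine Finset.sum_congr rfl fun m _ => ?_
    rw [partitionSum, Finset.mul_sum]
    refine Finset.sum_congr rfl fun P hP => ?_
    simp only [partTerm]
    rw [Finset.prod_smul, mul_smul_comm, (Finset.mem_filter.mp hP).2]
  · intro P _
    simpa [Nat.lt_succ_iff] using P.card_parts_le_card

lemma divPow_eOp_apply (a : ℤ) (F : Poly) : divPow eOp a F = x₁div a * F :=
  LinearMap.congr_fun (map_divPow (Algebra.lmul ℚ Poly) (x 1) a).symm F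

lemma fourierSum_eq_stringSum (g n : ℕ) (hν : ∀ i, 1 < ν i) : fourierSum g n ν =
    stringSum eOp (D g) (k + 1) (g - ∑ i, ν i - k - n) (∏ i, x (ν i)) := by
  rw [fourierSum_eq_sum, ← Finset.sum_range_reflect, stringSum_apply]
  refine Finset.sum_congr rfl fun j hj => ?_
  have hj := Finset.mem_range.mp hj
  rw [divPow_eOp_apply, divPow_D_prod g (m := k - j) (fun i _ => hν i) (by simp; lia),
    show k + 1 - 1 - j = k - j by lia]
  congr 2
  push_cast [show j ≤ k by lia]
  ring

end FourierSum

section Monomials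

variable {ι : Type*} {ν : ι → ℕ} {s : Finset ι}

/-- The exponent of the monomial `∏ i ∈ s, x (ν i)`, for `ν` positive on `s`. -/
def expo (ν : ι → ℕ) (s : Finset ι) : ℕ+ →₀ ℕ := ∑ i ∈ s, Finsupp.single (ν i).toPNat' 1

lemma monomial_expo (ν : ι → ℕ) (s : Finset ι) :
    monomial (expo ν s) (1 : ℚ) = ∏ i ∈ s, x (ν i) := by
  rw [expo, monomial_sum_one]
  rfl

lemma expo_one (hν : ∀ i ∈ s, 1 < ν i) : expo ν s 1 = 0 := by
  rw [expo, Finsupp.finsetSum_apply]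
  refine Finset.sum_eq_zero fun i hi => Finsupp.single_eq_of_ne' fun h => ?_
  have h_val := congrArg PNat.val h
  rw [Nat.toPNat'_coe, if_pos (one_pos.trans (hν i hi))] at h_val
  exact (hν i hi).ne' h_val

lemma weight_expo (hν : ∀ i ∈ s, 1 < ν i) : Finsupp.weight wt (expo ν s) = ∑ i ∈ s, ν i := by
  rw [expo, map_sum]
  refine Finset.sum_congr rfl fun i hi => ?_
  rw [Finsupp.weight_single, one_smul, wt, Nat.toPNat'_coe, if_pos (one_pos.trans (hν i hi))]

lemma weight_single_add_expo (n : ℕ) (hν : ∀ i ∈ s, 1 < ν i) :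
    Finsupp.weight wt (Finsupp.single 1 n + expo ν s) = n + ∑ i ∈ s, ν i := by
  simp [weight_expo hν, Finsupp.weight_single, wt]

lemma exists_eq_expo (m : ℕ+ →₀ ℕ) (h : m 1 = 0) :
    ∃ (k : ℕ) (ν : Fin k → ℕ), (∀ i, 1 < ν i) ∧ m = expo ν Finset.univ := by
  induction m using Finsupp.induction_linear with
  | zero => exact ⟨0, ![], by simp, by simp [expo]⟩
  | add m₁ m₂ h₁ h₂ =>
    rw [Finsupp.add_apply] at h
    obtain ⟨k, ν, hν, rfl⟩ := h₁ (by lia)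
    obtain ⟨l, μ, hμ, rfl⟩ := h₂ (by lia)
    refine ⟨k + l, Fin.append ν μ, fun i => ?_, by simp [expo, Fin.sum_univ_add]⟩
    induction i using Fin.addCases with
    | left i => simpa using hν i
    | right i => simpa using hμ i
  | single a n =>
    refine ⟨n, fun _ => a, fun i => ?_, by simp [expo]⟩
    rw [← PNat.one_coe, PNat.coe_lt_coe]
    refine one_le.lt_of_ne ?_
    rintro rfl
    rw [Finsupp.single_eq_same] at h
    exact (h ▸ i).elim0

lemma exists_eq_single_add_expo (m : ℕ+ →₀ ℕ) : ∃ (n k : ℕ) (ν : Fin k → ℕ), (∀ i, 1 < ν i) ∧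
    m = Finsupp.single 1 n + expo ν Finset.univ := by
  obtain ⟨k, ν, hν, h⟩ := exists_eq_expo (m.erase 1) (by simp)
  exact ⟨m 1, k, ν, hν, by rw [← h, Finsupp.single_add_erase]⟩

lemma x_one_pow (n : ℕ) : x 1 ^ n = (n.factorial : ℚ) • x₁div n := by
  simp [x₁div, smul_smul, Nat.factorial_ne_zero]

lemma monomial_single_add_expo (n : ℕ) (ν : ι → ℕ) (s : Finset ι) :
    monomial (Finsupp.single 1 n + expo ν s) (1 : ℚ) =
      (n.factorial : ℚ) • (x₁div n * ∏ i ∈ s, x (ν i)) := by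
  rw [← mul_one (1 : ℚ), ← monomial_mul, monomial_expo, ← X_pow_eq_monomial, ← x_pnat,
    PNat.one_coe, x_one_pow, smul_mul_assoc]

lemma isWeightedHomogeneous_x₁div_mul_prod (n : ℕ) (hν : ∀ i ∈ s, 1 < ν i) :
    IsWeightedHomogeneous wt (x₁div n * ∏ i ∈ s, x (ν i)) (n + ∑ i ∈ s, ν i) := by
  have hn : (n.factorial : ℚ) ≠ 0 := by positivity
  rw [← mem_weightedHomogeneousSubmodule, ← Submodule.smul_mem_iff _ hn, ← monomial_single_add_expo]
  exact isWeightedHomogeneous_monomial wt _ 1 (weight_single_add_expo n hν)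

lemma D_pow_x₁div_mul_prod_mem_I {g n : ℕ} (hν : ∀ i ∈ s, 1 < ν i) (hs : s.Nonempty)
    (h : n + ∑ i ∈ s, ν i = g) (d : ℕ) :
    (D g ^ d) (x₁div n * ∏ i ∈ s, x (ν i)) ∈ I g := by
  have hn : (n.factorial : ℚ) ≠ 0 := by positivity
  have sum_pos : 0 < ∑ i ∈ s, ν i := Finset.sum_pos (fun i hi => one_pos.trans (hν i hi)) hs
  rw [← Submodule.smul_mem_iff _ hn, ← map_smul, ← monomial_single_add_expo]
  refine Submodule.subset_span (Or.inl ⟨d, _, (weight_single_add_expo n hν).trans h, ?_, rfl⟩)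
  rw [Finsupp.add_apply, expo_one hν, Finsupp.single_eq_same]
  lia

variable {M : Type*} [AddCommGroup M] [Module ℚ M]

lemma map_mem_of_isWeightedHomogeneous {F : Poly} {e : ℕ} (hF : IsWeightedHomogeneous wt F e)
    (A : Poly →ₗ[ℚ] M) {p : Submodule ℚ M}
    (h : ∀ (n k : ℕ) (ν : Fin k → ℕ), (∀ i, 1 < ν i) → n + ∑ i, ν i = e →
      A (x₁div n * ∏ i, x (ν i)) ∈ p) : A F ∈ p := by
  rw [F.as_sum, map_sum]
  refine p.sum_mem fun m hm => ?_
  have weight_m : Finsupp.weight wt m = e := hF (mem_support_iff.mp hm)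
  obtain ⟨n, k, ν, hν, rfl⟩ := exists_eq_single_add_expo m
  rw [weight_single_add_expo n fun i _ => hν i] at weight_m
  rw [← mul_one (coeff _ F), ← smul_eq_mul, ← smul_monomial, monomial_single_add_expo, map_smul,
    map_smul]
  exact p.smul_mem _ (p.smul_mem _ (h n k ν hν weight_m))

lemma linearMap_ext {A B : Poly →ₗ[ℚ] M}
    (h : ∀ (n k : ℕ) (ν : Fin k → ℕ), (∀ i, 1 < ν i) →
      A (x₁div n * ∏ i, x (ν i)) = B (x₁div n * ∏ i, x (ν i))) : A = B := by
  refine (basisMonomials ℕ+ ℚ).ext fun m => ?_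
  obtain ⟨n, k, ν, hν, rfl⟩ := exists_eq_single_add_expo m
  rw [coe_basisMonomials]
  dsimp only
  rw [monomial_single_add_expo, map_smul, map_smul, h n k ν hν]

end Monomials

section StableRange

variable {g n e : ℕ} {ι : Type*} {ν : ι → ℕ} {s : Finset ι} {F : Poly}

lemma D_x₁div_mul_prod_mem [DecidableEq ι] (hν : ∀ i ∈ s, 1 < ν i) {p : Submodule ℚ Poly}
    (mem_pred : (n - 1 - (g - ∑ i ∈ s, ν i - s.card) : ℚ) •
      (x₁div (n - 1) * ∏ i ∈ s, x (ν i)) ∈ p)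
    (mem_merge : ∀ i ∈ s, ∀ j ∈ s.erase i,
      x₁div n * ∏ k ∈ s.erase j, x (merge ν i j k) ∈ p) :
    D g (x₁div n * ∏ i ∈ s, x (ν i)) ∈ p := by
  have hw := hOp_prod g fun i hi => one_pos.trans (hν i hi)
  rw [← divPow_eOp_apply, (isSl2Relation g).d_divPow_e_apply hw, divPow_eOp_apply,
    divPow_eOp_apply, D_prod g hν, Finset.mul_sum]
  refine p.add_mem (p.sum_mem fun i hi => ?_) (by exact_mod_cast mem_pred)
  rw [Finset.mul_sum]
  refine p.sum_mem fun j hj => ?_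
  rw [mul_smul_comm]
  exact p.smul_mem _ (mem_merge i hi j hj)

lemma isWeightedHomogeneous_D (hF : IsWeightedHomogeneous wt F (e + 1)) :
    IsWeightedHomogeneous wt (D g F) e := by
  refine map_mem_of_isWeightedHomogeneous hF (D g) (p := weightedHomogeneousSubmodule ℚ wt e)
    fun n k ν hν he => D_x₁div_mul_prod_mem (fun i _ => hν i) ?_ fun i hi j hj => ?_
  · refine Submodule.smul_mem _ _ ?_
    cases n with
    | zero => simp [x₁div]
    | succ n =>
      rw [show e = n + ∑ i, ν i by lia, Nat.cast_succ, add_sub_cancel_right]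
      exact isWeightedHomogeneous_x₁div_mul_prod n fun i _ => hν i
  · have hj' := Finset.mem_of_mem_erase hj
    have sum_eq := sum_merge hi hj' (Finset.ne_of_mem_erase hj).symm (one_pos.trans (hν i))
    rw [show e = n + ∑ k ∈ Finset.univ.erase j, merge ν i j k by lia]
    exact isWeightedHomogeneous_x₁div_mul_prod n (one_lt_merge (fun i _ => hν i) hi hj')

lemma isWeightedHomogeneous_D_pow {n : ℕ} (hF : IsWeightedHomogeneous wt F (e + n)) :
    IsWeightedHomogeneous wt ((D g ^ n) F) e := by
  induction n generalizing F with
  | zero => exact hF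
  | succ n ih =>
    rw [pow_succ, Module.End.mul_apply]
    exact ih (isWeightedHomogeneous_D hF)

lemma D_eq_zero_of_isWeightedHomogeneous_zero (hF : IsWeightedHomogeneous wt F 0) :
    D g F = 0 := by
  refine (Submodule.mem_bot ℚ).mp (map_mem_of_isWeightedHomogeneous hF (D g) fun n k ν hν he => ?_)
  obtain rfl : n = 0 := by lia
  cases k with
  | zero => simp [x₁div, D_one]
  | succ k =>
    rw [Fin.sum_univ_succ] at he
    have := hν 0
    lia

/-- The coefficient of `x₁ ^ g` in `D g (x₁ ^ (g + 1))` vanishes, so `D g` maps degree `g + 1` into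
the span of the monomials of degree `g` other than `x₁ ^ g`. -/
lemma D_pow_D_mem_I (hF : IsWeightedHomogeneous wt F (g + 1)) (d : ℕ) :
    (D g ^ d) (D g F) ∈ I g := by
  refine map_mem_of_isWeightedHomogeneous hF (D g) (p := (I g).comap (D g ^ d))
    fun n k ν hν he => D_x₁div_mul_prod_mem (fun i _ => hν i) ?_ fun i hi j hj => ?_
  · rcases k.eq_zero_or_pos with rfl | hk
    · simp_all
    cases n with
    | zero => simp [x₁div]
    | succ n =>
      refine Submodule.smul_mem _ _ ?_
      rw [Nat.cast_succ, add_sub_cancel_right]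
      exact D_pow_x₁div_mul_prod_mem_I (fun i _ => hν i) ⟨⟨0, hk⟩, Finset.mem_univ _⟩ (by lia) d
  · have hj' := Finset.mem_of_mem_erase hj
    have hij := (Finset.ne_of_mem_erase hj).symm
    have sum_eq := sum_merge hi hj' hij (one_pos.trans (hν i))
    exact D_pow_x₁div_mul_prod_mem_I (one_lt_merge (fun i _ => hν i) hi hj')
      ⟨i, Finset.mem_erase.mpr ⟨hij, hi⟩⟩ (by lia) d

lemma D_pow_succ_mem_I (g : ℕ) (F : Poly) : (D g ^ (g + 1)) F ∈ I g := by
  rw [F.as_sum, map_sum]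
  refine sum_mem fun m _ => ?_
  have hP := isWeightedHomogeneous_monomial wt m (coeff m F) rfl
  generalize monomial m (coeff m F) = P at hP ⊢
  generalize Finsupp.weight wt m = e at hP
  rcases lt_or_ge g e with he | he
  · obtain ⟨r, rfl⟩ := Nat.exists_eq_add_of_lt he
    rcases lt_or_ge g r with hr | hr
    · exact Submodule.subset_span
        (Or.inr ⟨r, hr, isWeightedHomogeneous_D_pow (by rwa [add_comm r, add_right_comm])⟩)
    · rw [show g + 1 = (g - r) + 1 + r by lia, pow_add, Module.End.mul_apply, pow_succ,
        Module.End.mul_apply]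
      exact D_pow_D_mem_I (isWeightedHomogeneous_D_pow (by rwa [add_right_comm])) _
  · have hD := isWeightedHomogeneous_D_pow (g := g) (e := 0) (by rwa [zero_add])
    rw [show g + 1 = (g - e) + 1 + e by lia, pow_add, Module.End.mul_apply, pow_succ,
      Module.End.mul_apply, D_eq_zero_of_isWeightedHomogeneous_zero hD, map_zero]
    exact zero_mem _

lemma x₁div_mul_prod_mem_stableRange (hν : ∀ i ∈ s, 1 < ν i) (h : g ≤ n + ∑ i ∈ s, ν i)
    (h' : n < g ∨ g < n + ∑ i ∈ s, ν i) :
    x₁div n * ∏ i ∈ s, x (ν i) ∈ stableRange (D g) := by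
  rw [← divPow_eOp_apply]
  refine (isSl2Relation g).divPow_e_apply_mem_stableRange (N := max s.card 1)
    (D_pow_prod_eq_zero g hν (by simp) (by simp))
    (hOp_prod g fun i hi => one_pos.trans (hν i hi)) ?_
  have sum_eq_zero : s.card = 0 → ∑ i ∈ s, ν i = 0 := by simp +contextual
  push_cast [← Nat.cast_sum]
  lia

lemma I_le_stableRange (g : ℕ) : I g ≤ stableRange (D g) := by
  refine Submodule.span_le.mpr ?_
  rintro F (⟨d, m, weight_m, m_one, rfl⟩ | ⟨e, he, hF⟩)
  · obtain ⟨n, k, ν, hν, rfl⟩ := exists_eq_single_add_expo m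
    rw [weight_single_add_expo n fun i _ => hν i] at weight_m
    rw [Finsupp.add_apply, expo_one fun i _ => hν i, Finsupp.single_eq_same, add_zero] at m_one
    rw [monomial_single_add_expo]
    exact pow_apply_mem_stableRange (Submodule.smul_mem _ _
      (x₁div_mul_prod_mem_stableRange (fun i _ => hν i) weight_m.ge (Or.inl m_one))) d
  · exact map_mem_of_isWeightedHomogeneous hF LinearMap.id fun n k ν hν h =>
      x₁div_mul_prod_mem_stableRange (fun i _ => hν i) (by lia) (Or.inr (by lia))

theorem I_eq_stableRange (g : ℕ) : I g = stableRange (D g) := by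
  refine (I_le_stableRange g).antisymm fun F hF => ?_
  obtain ⟨G, rfl⟩ := mem_stableRange.mp hF (g + 1)
  exact D_pow_succ_mem_I g G

end StableRange

namespace IsSl2Relation

variable {L : Type*} [LieRing L] [LieAlgebra ℚ L] {h e d : L}

/-- The homomorphism from `sl₂` mapping `E`, `Fm`, `H` to `e`, `-d`, `h`. -/
def lieHom (rel : IsSl2Relation h e d) : sl₂ →ₗ⁅ℚ⁆ L where
  toFun A := A.1 0 1 • e - A.1 1 0 • d + A.1 0 0 • h
  map_add' A B := by
    simp only [AddMemClass.coe_add, Matrix.add_apply]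
    module
  map_smul' a A := by
    simp only [SetLike.val_smul, Matrix.smul_apply, smul_eq_mul, RingHom.id_apply]
    module
  map_lie' {A B} := by
    have apply_one_one (A : sl₂) : A.1 1 1 = -A.1 0 0 := by
      have trace_A : Matrix.trace A.1 = 0 := A.2
      rw [Matrix.trace_fin_two] at trace_A
      linarith
    simp only [add_lie, lie_add, sub_lie, lie_sub, smul_lie, lie_smul, lie_self, rel.lie_d_e,
      rel.lie_h_e, rel.lie_h_d, ← lie_skew e d, ← lie_skew e h, ← lie_skew d h,
      LieSubalgebra.coe_bracket, Ring.lie_def, Matrix.sub_apply, Matrix.mul_apply,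
      Fin.sum_univ_two, apply_one_one]
    module

lemma lieHom_apply (rel : IsSl2Relation h e d) (A : sl₂) :
    rel.lieHom A = A.1 0 1 • e - A.1 1 0 • d + A.1 0 0 • h := rfl

lemma lieHom_E (rel : IsSl2Relation h e d) : rel.lieHom E = e := by simp [lieHom_apply, E]

lemma lieHom_Fm (rel : IsSl2Relation h e d) : rel.lieHom Fm = -d := by simp [lieHom_apply, Fm]

lemma lieHom_H (rel : IsSl2Relation h e d) : rel.lieHom H = h := by simp [lieHom_apply, H]

end IsSl2Relation

section Quotient

variable {V : Type*} [AddCommGroup V] [Module ℚ V] {p : Submodule ℚ V} {h e d : Module.End ℚ V}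

lemma IsSl2Relation.mapQ (rel : IsSl2Relation h e d) (hh : p ≤ p.comap h) (he : p ≤ p.comap e)
    (hd : p ≤ p.comap d) : IsSl2Relation (p.mapQ p h hh) (p.mapQ p e he) (p.mapQ p d hd) where
  lie_d_e := p.linearMap_qext (LinearMap.ext fun v =>
    congrArg p.mkQ (LinearMap.congr_fun rel.lie_d_e v))
  lie_h_e := p.linearMap_qext (LinearMap.ext fun v =>
    congrArg p.mkQ (LinearMap.congr_fun rel.lie_h_e v))
  lie_h_d := p.linearMap_qext (LinearMap.ext fun v =>
    congrArg p.mkQ (LinearMap.congr_fun rel.lie_h_d v))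

lemma IsSl2Relation.lieHom_apply_mem (rel : IsSl2Relation h e d) (hh : p ≤ p.comap h)
    (he : p ≤ p.comap e) (hd : p ≤ p.comap d) (A : sl₂) {v : V} (hv : v ∈ p) :
    rel.lieHom A v ∈ p :=
  p.add_mem (p.sub_mem (p.smul_mem _ (he hv)) (p.smul_mem _ (hd hv))) (p.smul_mem _ (hh hv))

lemma IsSl2Relation.lieHom_mapQ_mkQ (rel : IsSl2Relation h e d) (hh : p ≤ p.comap h)
    (he : p ≤ p.comap e) (hd : p ≤ p.comap d) (A : sl₂) (v : V) :
    (rel.mapQ hh he hd).lieHom A (p.mkQ v) = p.mkQ (rel.lieHom A v) := rfl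

lemma mapQ_pow_mkQ (hd : p ≤ p.comap d) (n : ℕ) (v : V) :
    (p.mapQ p d hd ^ n) (p.mkQ v) = p.mkQ ((d ^ n) v) := by
  rw [← p.mapQ_pow hd n]
  rfl

lemma isNilpotent_mapQ (hd : p ≤ p.comap d) {n : ℕ} (h : ∀ v, (d ^ n) v ∈ p) :
    IsNilpotent (p.mapQ p d hd) :=
  ⟨n, p.linearMap_qext (LinearMap.ext fun v =>
    (mapQ_pow_mkQ hd n v).trans ((Submodule.Quotient.mk_eq_zero p).mpr (h v)))⟩

lemma divPow_mapQ_mkQ (hd : p ≤ p.comap d) (a : ℤ) (v : V) :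
    divPow (p.mapQ p d hd) a (p.mkQ v) = p.mkQ (divPow d a v) := by
  rcases lt_or_ge a 0 with ha | ha
  · simp [divPow_of_neg _ ha]
  · lift a to ℕ using ha
    simp only [divPow_natCast, LinearMap.smul_apply, mapQ_pow_mkQ, map_smul]

lemma stringSum_mapQ_mkQ (he : p ≤ p.comap e) (hd : p ≤ p.comap d) (N : ℕ) (a : ℤ) (v : V) :
    stringSum (p.mapQ p e he) (p.mapQ p d hd) N a (p.mkQ v) = p.mkQ (stringSum e d N a v) := by
  simp only [stringSum_apply, divPow_mapQ_mkQ, map_sum]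

end Quotient

section FourierOperator

lemma I_le_comap_eOp (g : ℕ) : I g ≤ (I g).comap eOp := by
  rw [I_eq_stableRange]
  exact fun F hF => mul_mem_stableRange g (x 1) hF

lemma I_le_comap_D (g : ℕ) : I g ≤ (I g).comap (D g) := by
  rw [I_eq_stableRange]
  exact fun F hF => pow_one (D g) ▸ pow_apply_mem_stableRange hF 1

lemma I_le_comap_hOp (g : ℕ) : I g ≤ (I g).comap (hOp g) := fun F hF => by
  rw [Submodule.mem_comap, ← (isSl2Relation g).lie_d_e, Ring.lie_def, LinearMap.sub_apply]
  exact sub_mem (I_le_comap_D g (I_le_comap_eOp g hF)) (I_le_comap_eOp g (I_le_comap_D g hF))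

lemma mul_mem_I {g : ℕ} (F : Poly) {G : Poly} (hG : G ∈ I g) : F * G ∈ I g := by
  rw [I_eq_stableRange] at hG ⊢
  exact mul_mem_stableRange g F hG

/-- `I g` as an ideal of `Poly`. -/
def idealI (g : ℕ) : Ideal Poly where
  __ := (I g).toAddSubmonoid
  smul_mem' F _ hG := mul_mem_I F hG

/-- `R g` as the quotient of the ring `Poly` by the ideal `idealI g`, which makes `R g` a
commutative ring. -/
def quotEquiv (g : ℕ) : R g ≃ₗ[ℚ] Poly ⧸ idealI g :=
  (Submodule.quotEquivOfEq _ ((idealI g).restrictScalars ℚ) rfl).trans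
    (Submodule.Quotient.restrictScalarsEquiv ℚ (idealI g))

/-- The operator induced by `eOp` on `R g`. -/
def quotE (g : ℕ) : Module.End ℚ (R g) := (I g).mapQ (I g) eOp (I_le_comap_eOp g)

/-- The operator induced by `D g` on `R g`. -/
def quotD (g : ℕ) : Module.End ℚ (R g) := (I g).mapQ (I g) (D g) (I_le_comap_D g)

/-- The operator induced by `hOp g` on `R g`. -/
def quotH (g : ℕ) : Module.End ℚ (R g) := (I g).mapQ (I g) (hOp g) (I_le_comap_hOp g)

lemma isSl2Relation_quot (g : ℕ) : IsSl2Relation (quotH g) (quotE g) (quotD g) :=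
  (isSl2Relation g).mapQ _ _ _

lemma eOp_pow_succ_mem_I (g : ℕ) (F : Poly) : (eOp ^ (g + 1)) F ∈ I g := by
  rw [eOp, LinearMap.pow_mulLeft, F.as_sum, map_sum]
  refine sum_mem fun m _ => Submodule.subset_span
    (Or.inr ⟨g + 1 + Finsupp.weight wt m, by lia, ?_⟩)
  have hx : IsWeightedHomogeneous wt (x 1) 1 := isWeightedHomogeneous_X ℚ wt 1
  simpa using (hx.pow (g + 1)).mul (isWeightedHomogeneous_monomial wt m (coeff m F) rfl)

lemma isNilpotent_quotE (g : ℕ) : IsNilpotent (quotE g) :=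
  isNilpotent_mapQ _ (eOp_pow_succ_mem_I g)

lemma isNilpotent_quotD (g : ℕ) : IsNilpotent (quotD g) :=
  isNilpotent_mapQ _ (D_pow_succ_mem_I g)

/-- The Fourier operator on `R g`: the element `exp d * exp e * exp d` of `SL₂`, for `e`, `d` the
operators induced by `eOp`, `D g`. -/
def fourier (g : ℕ) : R g ≃ₗ[ℚ] R g :=
  LinearEquiv.ofBijective (weyl (quotE g) (quotD g)) ((Module.End.isUnit_iff _).mp
    (isUnit_weyl (isNilpotent_quotE g) (isNilpotent_quotD g)))

lemma fourierFormula_fourier (g : ℕ) : FourierFormula g (fourier g).toLinearMap := by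
  intro n k ν hν
  have hw := congrArg (I g).mkQ (hOp_prod g (s := Finset.univ) fun i _ => one_pos.trans (hν i))
  have hN : (quotD g ^ (k + 1)) ((I g).mkQ (∏ i, x (ν i))) = 0 := by
    rw [quotD, mapQ_pow_mkQ, D_pow_prod_eq_zero g (fun i _ => hν i) k.succ_pos (by simp), map_zero]
  rw [fourierSum_eq_stringSum g n hν, ← stringSum_mapQ_mkQ (I_le_comap_eOp g) (I_le_comap_D g),
    ← divPow_eOp_apply, ← divPow_mapQ_mkQ (I_le_comap_eOp g)]
  change _ • weyl (quotE g) (quotD g) (divPow (quotE g) n _) = stringSum (quotE g) (quotD g) _ _ _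
  rw [(isSl2Relation_quot g).weyl_divPow_e_apply (isNilpotent_quotE g) (isNilpotent_quotD g) hw hN,
    smul_smul, ← mul_pow, neg_one_mul, neg_neg, one_pow, one_smul, Finset.card_univ,
    Fintype.card_fin]

lemma FourierFormula.eq {g : ℕ} {S T : R g →ₗ[ℚ] R g} (hS : FourierFormula g S)
    (hT : FourierFormula g T) : S = T :=
  (I g).linearMap_qext <| linearMap_ext fun n k ν hν =>
    smul_right_injective _ (pow_ne_zero n (neg_ne_zero.mpr one_ne_zero) : (-1 : ℚ) ^ n ≠ 0)
      ((hS n k ν hν).trans (hT n k ν hν).symm)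

lemma fourier_fourier_apply (g n : ℕ) {k : ℕ} {ν : Fin k → ℕ} (hν : ∀ i, 1 < ν i) :
    fourier g (fourier g ((I g).mkQ (x 1 ^ n * ∏ i, x (ν i)))) =
      (-1 : ℚ) ^ (g + k + ∑ i, ν i) • (I g).mkQ (x 1 ^ n * ∏ i, x (ν i)) := by
  set F := x 1 ^ n * ∏ i, x (ν i) with F_def
  set c : ℤ := g - (n + ∑ i, ν i : ℕ) - (n + k : ℕ) with c_def
  have hF : hOp g F = -(c : ℚ) • F := by
    have := hOp_prod g (s := Finset.univ) (ν := Sum.elim (fun _ : Fin n => 1) ν)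
      (by simp +contextual [fun i => one_pos.trans (hν i)])
    simpa [F_def, c_def] using this
  have neg_one_zpow : (-1 : ℚ) ^ c = (-1) ^ (g + k + ∑ i, ν i) := by
    rw [← zpow_natCast, show c = (g + k + ∑ i, ν i : ℕ) - 2 * (n + k + ∑ i, ν i : ℕ) by
      push_cast [c_def]; ring, zpow_sub₀ (by norm_num), zpow_mul]
    simp
  rw [← neg_one_zpow]
  exact (isSl2Relation_quot g).weyl_weyl_apply (isNilpotent_quotE g) (isNilpotent_quotD g)
    (congrArg (I g).mkQ hF)

lemma fourier_comp_comp_symm {g : ℕ} {A B : Module.End ℚ (R g)}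
    (semiconj : SemiconjBy (weyl (quotE g) (quotD g)) A B) :
    (fourier g).toLinearMap ∘ₗ A ∘ₗ (fourier g).symm.toLinearMap = B := by
  refine LinearMap.ext fun v => ?_
  obtain ⟨w, rfl⟩ := (fourier g).surjective v
  simp only [LinearMap.comp_apply, LinearEquiv.coe_coe, LinearEquiv.symm_apply_apply]
  exact LinearMap.congr_fun semiconj.eq w

lemma fourier_conj_quotE (g : ℕ) :
    (fourier g).toLinearMap ∘ₗ quotE g ∘ₗ (fourier g).symm.toLinearMap = quotD g :=
  fourier_comp_comp_symm <|
    (isSl2Relation_quot g).semiconjBy_weyl_e (isNilpotent_quotE g) (isNilpotent_quotD g)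

lemma fourier_conj_neg_quotD (g : ℕ) :
    (fourier g).toLinearMap ∘ₗ (-quotD g) ∘ₗ (fourier g).symm.toLinearMap = -quotE g :=
  fourier_comp_comp_symm <|
    ((isSl2Relation_quot g).semiconjBy_weyl_d
      (isNilpotent_quotE g) (isNilpotent_quotD g)).neg_right

lemma fourier_conj_quotH (g : ℕ) :
    (fourier g).toLinearMap ∘ₗ quotH g ∘ₗ (fourier g).symm.toLinearMap = -quotH g :=
  fourier_comp_comp_symm <|
    (isSl2Relation_quot g).semiconjBy_weyl_h (isNilpotent_quotE g) (isNilpotent_quotD g)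

end FourierOperator

end

end JacobianRing

theorem theorem3 (g : ℕ) (hg : 2 ≤ g) :
    -- (i)
    JacobianRing.I g = ⨅ (n : ℕ) (_ : 1 ≤ n), LinearMap.range (JacobianRing.D g ^ n) ∧
    -- (ii)
    (∃ J : Ideal JacobianRing.Poly, (∀ F, F ∈ J ↔ F ∈ JacobianRing.I g) ∧
      ∃ φ : JacobianRing.R g ≃ₗ[ℚ] (JacobianRing.Poly ⧸ J),
        ∀ F, φ ((JacobianRing.I g).mkQ F) = Ideal.Quotient.mk J F) ∧
    -- (iii) and (iv)
    (∃ ρ : JacobianRing.sl₂ →ₗ⁅ℚ⁆ Module.End ℚ JacobianRing.Poly,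
      ρ JacobianRing.E = JacobianRing.eOp ∧
      ρ JacobianRing.Fm = JacobianRing.fOp g ∧
      ρ JacobianRing.H = JacobianRing.hOp g ∧
      (∀ A, ∀ F ∈ JacobianRing.I g, ρ A F ∈ JacobianRing.I g) ∧
      ∃ ρR : JacobianRing.sl₂ →ₗ⁅ℚ⁆ Module.End ℚ (JacobianRing.R g),
        (∀ A F, ρR A ((JacobianRing.I g).mkQ F) = (JacobianRing.I g).mkQ (ρ A F)) ∧
        ∃ S : JacobianRing.R g ≃ₗ[ℚ] JacobianRing.R g,
          JacobianRing.FourierFormula g S.toLinearMap ∧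
          (∀ T : JacobianRing.R g →ₗ[ℚ] JacobianRing.R g,
            JacobianRing.FourierFormula g T → T = S.toLinearMap) ∧
          (∀ (n k : ℕ) (ν : Fin k → ℕ), (∀ i, 1 < ν i) →
            S (S ((JacobianRing.I g).mkQ
              (JacobianRing.x 1 ^ n * ∏ i, JacobianRing.x (ν i)))) =
            (-1 : ℚ) ^ (g + k + ∑ i, ν i) • (JacobianRing.I g).mkQ
              (JacobianRing.x 1 ^ n * ∏ i, JacobianRing.x (ν i))) ∧
          S.toLinearMap ∘ₗ ρR JacobianRing.E ∘ₗ S.symm.toLinearMap = -ρR JacobianRing.Fm ∧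
          S.toLinearMap ∘ₗ ρR JacobianRing.Fm ∘ₗ S.symm.toLinearMap = -ρR JacobianRing.E ∧
          S.toLinearMap ∘ₗ ρR JacobianRing.H ∘ₗ S.symm.toLinearMap = -ρR JacobianRing.H) := by
  have hh := JacobianRing.I_le_comap_hOp g
  have he := JacobianRing.I_le_comap_eOp g
  have hd := JacobianRing.I_le_comap_D g
  have rel := JacobianRing.isSl2Relation g
  have relR := JacobianRing.isSl2Relation_quot g
  refine ⟨(JacobianRing.I_eq_stableRange g).trans (JacobianRing.stableRange_eq_iInf_one_le _),
    ⟨JacobianRing.idealI g, fun _ => Iff.rfl, JacobianRing.quotEquiv g, fun _ => rfl⟩,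
    rel.lieHom, rel.lieHom_E, rel.lieHom_Fm, rel.lieHom_H,
    fun A _ => rel.lieHom_apply_mem hh he hd A,
    relR.lieHom, rel.lieHom_mapQ_mkQ hh he hd, JacobianRing.fourier g,
    JacobianRing.fourierFormula_fourier g,
    fun _ hT => hT.eq (JacobianRing.fourierFormula_fourier g),
    fun n _ _ hν => JacobianRing.fourier_fourier_apply g n hν, ?_, ?_, ?_⟩
  · rw [relR.lieHom_E, relR.lieHom_Fm, neg_neg, JacobianRing.fourier_conj_quotE]
  · rw [relR.lieHom_E, relR.lieHom_Fm, JacobianRing.fourier_conj_neg_quotD]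
  · rw [relR.lieHom_H, JacobianRing.fourier_conj_quotH]
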